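/- Let $x>0$ be real. For $\Re(s)>2/3$ the double series $$\Theta(s,s,s,x)=\sum_{n=1}^{\infty}\sum_{m=1}^{\infty}\frac{1}{n^{s}m^{s}(n+mx)^{s}}$$ converges absolutely, and its sum extends to a meromorphic function of $s$ on all of $\mathbb{C}$, again denoted $\Theta(s,s,s,x)$ (with removable singularities removed). Its singularities are exactly the points $s=\frac23$ and $s=\frac12-j$ for integers $j\ge 0$, and all of them are simple poles. Moreover, as $s\to\frac23$, $$\Theta(s,s,s,x)=\frac{\Gamma\left(\frac13\right)^3}{2\sqrt3\,\pi\,x^{1/3}\left(s-\frac23\right)}+O(1),$$ and, for every integer $j\ge 0$, as $s\to\frac12-j$, $$\Theta(s,s,s,x)=(-1)^j\,2^{-4j-1}\binom{2j}{j}\left(x^{2j}+x^{-\frac12-j}\right)\frac{\zeta\left(\frac{1-6j}{2}\right)}{s-\left(\frac12-j\right)}+O(1),$$ where $\zeta$ is the Riemann zeta function. -/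

import Mathlib

open Filter Topology Asymptotics

noncomputable section

/-- The general term `1 / (n ^ r * m ^ s * (n + m * x) ^ t)` of the generalized Mordell-Tornheim
series, where `n = p.1 + 1` and `m = p.2 + 1` run through the positive integers. All bases are
positive reals when `0 < x`, so the complex powers are the principal ones. -/
def thetaTerm (r s t : ℂ) (x : ℝ) (p : ℕ × ℕ) : ℂ :=
  1 / ((((p.1 : ℝ) + 1 : ℝ) : ℂ) ^ r * (((p.2 : ℝ) + 1 : ℝ) : ℂ) ^ s *
    ((((p.1 : ℝ) + 1) + ((p.2 : ℝ) + 1) * x : ℝ) : ℂ) ^ t)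

/-- The generalized Mordell-Tornheim zeta function in its region of absolute convergence,
as the sum of the double series. -/
def thetaSeries (r s t : ℂ) (x : ℝ) : ℂ :=
  ∑' p : ℕ × ℕ, thetaTerm r s t x p

/-- `F` is a meromorphic continuation to the whole complex plane of the function
`s ↦ Θ(s, s, s, x)`, which is given for `2 / 3 < Re s` by the double series. -/
structure IsThetaDiagContinuation (x : ℝ) (F : ℂ → ℂ) : Prop where
  meromorphic : Meromorphic F
  eq_series : ∀ s : ℂ, 2 / 3 < s.re → F s = thetaSeries s s s x

end

/-! Write `L_s(t) = ∑ n^(-s) e^(-nt)`. For `Re s > 2/3`, integrating the double series termwise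
gives `Γ(s) Θ(s,s,s,x) = ∫_0^∞ t^(s-1) L_s(t) L_s(xt) dt`. Only the first factor is expanded at `t =
0`: `L_s(t) = Γ(1-s) t^(s-1) + ∑_{k ≤ K} ζ(s-k) (-t)^k / k! + O(t^(K+1))`. Against the second factor
every power of `t` integrates exactly, since the Mellin transform of `L_s(xt)` at `w` is `x^(-w)
Γ(w) ζ(s+w)`. The remainder integral is holomorphic for `-K/2 < Re s < 1` (`Gamma_mul_thetaSeries`,
`differentiableOn_mellinRem`).

After division by `Γ(s)` the poles can be read off. The leading term carries `Γ(s-1/2) ζ(3s-1)`,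
with poles at `1/2 - j` and `2/3`. The `k`-th term carries `(s)_k ζ(2s+k)`: for odd `k` the
Pochhammer factor kills the pole, and for `k = 2j` there is a second pole at `1/2 - j`. Both
contributions there are multiples of `ζ(1/2-3j)` with coefficients of the same sign, so they cannot
cancel, and `ζ(1/2-3j) ≠ 0` (`riemannZeta_half_sub_ne_zero`).

The expansion of `L_s` comes from Poisson summation for `Re s < 0`, where the functional equation
identifies the constant term as `ζ(s)`. It is carried to `Re s < 1` and to all orders by the
relation `d/dt L_s = -L_(s-1)`. The strips are glued by the identity theorem. -/

/-! ### Holomorphy of parametric integrals -/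

/-- A parametric integral of holomorphic functions with a locally uniform integrable bound is
holomorphic. -/
theorem differentiableOn_integral_of_locally_dominated {α : Type*} [MeasurableSpace α]
    {μ : MeasureTheory.Measure α} {F : ℂ → α → ℂ} {U : Set ℂ} (hU : IsOpen U)
    (hmeas : ∀ s ∈ U, MeasureTheory.AEStronglyMeasurable (F s) μ)
    (hdiff : ∀ᵐ a ∂μ, DifferentiableOn ℂ (fun s => F s a) U)
    (hbound : ∀ s₀ ∈ U, ∃ V ∈ 𝓝 s₀, ∃ b : α → ℝ, MeasureTheory.Integrable b μ ∧
      ∀ᵐ a ∂μ, ∀ s ∈ V, ‖F s a‖ ≤ b a) :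
    DifferentiableOn ℂ (fun s => ∫ a, F s a ∂μ) U := by
  intro s₀ hs₀
  obtain ⟨V, hV, b, hb, hle⟩ := hbound s₀ hs₀
  obtain ⟨ε, hε, hball⟩ := Metric.mem_nhds_iff.mp (Filter.inter_mem hV (hU.mem_nhds hs₀))
  have hε3 : 0 < ε / 3 := by positivity
  have hint : ∀ s ∈ Metric.ball s₀ ε, MeasureTheory.Integrable (F s) μ := fun s hs =>
    hb.mono' (hmeas s (hball hs).2) (by filter_upwards [hle] with a ha using ha s (hball hs).1)
  have hball' : ∀ s ∈ Metric.ball s₀ (ε / 3), Metric.closedBall s (ε / 3) ⊆ Metric.ball s₀ ε := by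
    intro s hs z hz
    have h1 := Metric.mem_ball.mp hs
    have h2 := Metric.mem_closedBall.mp hz
    have := dist_triangle z s s₀
    exact Metric.mem_ball.mpr (by linarith)
  -- Cauchy's estimate on circles of radius `ε / 3` bounds the `s`-derivative by `b / (ε / 3)`;
  -- circles centred in the ball of radius `ε / 3` stay inside the ball of radius `ε`.
  have key := hasDerivAt_integral_of_dominated_loc_of_deriv_le (μ := μ) (F := F)
    (F' := fun s a => deriv (fun s => F s a) s) (x₀ := s₀) (bound := fun a => b a / (ε / 3))
    (Metric.ball_mem_nhds s₀ hε3)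
    (by filter_upwards [Metric.ball_mem_nhds s₀ hε] with s hs using hmeas s (hball hs).2)
    (hint s₀ (Metric.mem_ball_self hε)) ?_ ?_ (hb.div_const _) ?_
  · exact key.2.differentiableAt.differentiableWithinAt
  -- Measurability of the derivative: it is the limit of difference quotients along `s₀ + ε / (n +
  -- 2)`, where the `2` keeps even the point `n = 0` inside the open ball.
  · have hseq : Tendsto (fun n : ℕ => s₀ + ((ε / (n + 2) : ℝ) : ℂ)) atTop (𝓝[≠] s₀) := by
      refine tendsto_nhdsWithin_iff.mpr ⟨?_, Eventually.of_forall fun n => ?_⟩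
      · have h1 : Tendsto (fun n : ℕ => ε / ((n : ℝ) + 2)) atTop (𝓝 0) :=
          tendsto_const_nhds.div_atTop
            (tendsto_atTop_add_const_right _ _ tendsto_natCast_atTop_atTop)
        have h2 := (Complex.continuous_ofReal.tendsto 0).comp h1
        simpa using tendsto_const_nhds.add h2
      · have : (0 : ℝ) < ε / (n + 2) := by positivity
        simp only [Set.mem_compl_iff, Set.mem_singleton_iff, add_eq_left, Complex.ofReal_eq_zero]
        exact this.ne'
    refine aestronglyMeasurable_of_tendsto_ae atTop
      (f := fun (n : ℕ) a => slope (fun s => F s a) s₀ (s₀ + ((ε / (n + 2) : ℝ) : ℂ)))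
      (fun n => ?_) ?_
    · simp only [slope_def_module]
      suffices hn : s₀ + ((ε / (n + 2) : ℝ) : ℂ) ∈ Metric.ball s₀ ε from
        ((hint _ hn).aestronglyMeasurable.sub
          (hint s₀ (Metric.mem_ball_self hε)).aestronglyMeasurable).const_smul
            (s₀ + ((ε / (n + 2) : ℝ) : ℂ) - s₀)⁻¹
      have h0 : (0 : ℝ) < n + 2 := by positivity
      have : (0 : ℝ) < ε / (n + 2) := by positivity
      rw [Metric.mem_ball, dist_eq_norm, add_sub_cancel_left, Complex.norm_real,
        Real.norm_of_nonneg this.le, div_lt_iff₀ h0]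
      nlinarith [(Nat.cast_nonneg n : (0 : ℝ) ≤ n)]
    · filter_upwards [hdiff] with a ha
      have := (ha.differentiableAt (hU.mem_nhds hs₀)).hasDerivAt
      exact (hasDerivAt_iff_tendsto_slope.mp this).comp hseq
  · filter_upwards [hle, hdiff] with a ha hd s hs
    refine Complex.norm_deriv_le_of_forall_mem_sphere_norm_le hε3 ?_ fun z hz =>
      ha z (hball (hball' s hs (Metric.sphere_subset_closedBall hz))).1
    refine (hd.mono fun z hz => (hball (hball' s hs ?_)).2).diffContOnCl
    rwa [closure_ball _ hε3.ne'] at hz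
  · filter_upwards [hdiff] with a hd s hs
    refine (hd.differentiableAt (hU.mem_nhds (hball ?_).2)).hasDerivAt
    exact hball' s hs (Metric.mem_closedBall_self hε3.le)

/-! ### The polylogarithm at `exp (-t)` -/

/-- `∑ n ≥ 1, n ^ (-s) * exp (-n * t)`, the polylogarithm of order `s` at `exp (-t)`. -/
noncomputable def polylogExp (s : ℂ) (t : ℝ) : ℂ :=
  ∑' n : ℕ, (((n : ℝ) + 1 : ℝ) : ℂ) ^ (-s) * ((Real.exp (-((n : ℝ) + 1) * t) : ℝ) : ℂ)

theorem norm_natCast_add_one_cpow (n : ℕ) (s : ℂ) :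
    ‖(((n : ℝ) + 1 : ℝ) : ℂ) ^ s‖ = ((n : ℝ) + 1) ^ s.re :=
  Complex.norm_cpow_eq_rpow_re_of_pos (by positivity) _

theorem norm_polylogExp_term (n : ℕ) (s : ℂ) (t : ℝ) :
    ‖(((n : ℝ) + 1 : ℝ) : ℂ) ^ (-s) * ((Real.exp (-((n : ℝ) + 1) * t) : ℝ) : ℂ)‖ =
      ((n : ℝ) + 1) ^ (-s.re) * Real.exp (-((n : ℝ) + 1) * t) := by
  rw [norm_mul, norm_natCast_add_one_cpow, Complex.norm_real, Real.norm_of_nonneg (Real.exp_pos _).le,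
    Complex.neg_re]

theorem summable_rpow_mul_exp_neg (c : ℝ) {t : ℝ} (ht : 0 < t) :
    Summable fun n : ℕ => ((n : ℝ) + 1) ^ c * Real.exp (-((n : ℝ) + 1) * t) := by
  obtain ⟨k, hk⟩ := exists_nat_ge c
  have h := (summable_nat_add_iff 1).mpr (Real.summable_pow_mul_exp_neg_nat_mul k ht)
  refine h.of_nonneg_of_le (fun n => by positivity) fun n => ?_
  push_cast
  have h1 : ((n : ℝ) + 1) ^ c ≤ ((n : ℝ) + 1) ^ k := by
    rw [← Real.rpow_natCast]
    exact Real.rpow_le_rpow_of_exponent_le (by linarith [(Nat.cast_nonneg n : (0 : ℝ) ≤ n)]) hk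
  have h2 : -((n : ℝ) + 1) * t = -t * (n + 1) := by ring
  rw [h2]
  gcongr

theorem hasSum_polylogExp (s : ℂ) {t : ℝ} (ht : 0 < t) :
    HasSum (fun n : ℕ => (((n : ℝ) + 1 : ℝ) : ℂ) ^ (-s) *
      ((Real.exp (-((n : ℝ) + 1) * t) : ℝ) : ℂ)) (polylogExp s t) := by
  refine Summable.hasSum (.of_norm ?_)
  simpa only [norm_polylogExp_term] using summable_rpow_mul_exp_neg (-s.re) ht

theorem polylogExp_ofReal (σ t : ℝ) : polylogExp σ t =
    ((∑' n : ℕ, ((n : ℝ) + 1) ^ (-σ) * Real.exp (-((n : ℝ) + 1) * t) : ℝ) : ℂ) := by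
  rw [polylogExp, Complex.ofReal_tsum]
  refine tsum_congr fun n => ?_
  rw [Complex.ofReal_mul, Complex.ofReal_cpow (by positivity), Complex.ofReal_neg]

/-- `polylogExp s t` is dominated by its value at a real order below `Re s`. -/
theorem norm_polylogExp_le {s : ℂ} {σ t : ℝ} (hσ : σ ≤ s.re) (ht : 0 < t) :
    ‖polylogExp s t‖ ≤ ∑' n : ℕ, ((n : ℝ) + 1) ^ (-σ) * Real.exp (-((n : ℝ) + 1) * t) := by
  refine tsum_of_norm_bounded (summable_rpow_mul_exp_neg (-σ) ht).hasSum fun n => ?_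
  rw [norm_polylogExp_term]
  gcongr
  linarith [(Nat.cast_nonneg n : (0 : ℝ) ≤ n)]

theorem differentiable_polylogExp {t : ℝ} (ht : 0 < t) :
    Differentiable ℂ fun s => polylogExp s t := by
  intro s₀
  have hU : IsOpen {s : ℂ | s₀.re - 1 < s.re} := isOpen_lt continuous_const Complex.continuous_re
  refine (Complex.differentiableOn_tsum_of_summable_norm
    (summable_rpow_mul_exp_neg (-(s₀.re - 1)) ht) (fun n => ?_) hU fun n s hs => ?_).differentiableAt
      (hU.mem_nhds (by simp))
  · refine DifferentiableOn.mul_const (Differentiable.differentiableOn ?_) _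
    refine (differentiable_id.neg).const_cpow (Or.inl ?_)
    exact_mod_cast (by positivity : (n : ℝ) + 1 ≠ 0)
  · rw [norm_polylogExp_term]
    have : s₀.re - 1 < s.re := hs
    gcongr
    linarith [(Nat.cast_nonneg n : (0 : ℝ) ≤ n)]

/-- Each term gains a factor `-(n + 1)`, which lowers the order by one; on `(t / 2, ∞)` the
differentiated terms have a common summable majorant. Every later gain in the order of `t`, or in
the range of `s`, comes from integrating this relation. -/
theorem hasDerivAt_polylogExp (s : ℂ) {t : ℝ} (ht : 0 < t) :
    HasDerivAt (polylogExp s) (-polylogExp (s - 1) t) t := by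
  have key := hasDerivAt_tsum_of_isPreconnected (𝕜 := ℝ)
    (g := fun (n : ℕ) (t : ℝ) => (((n : ℝ) + 1 : ℝ) : ℂ) ^ (-s) *
      ((Real.exp (-((n : ℝ) + 1) * t) : ℝ) : ℂ))
    (g' := fun (n : ℕ) (t : ℝ) => -((((n : ℝ) + 1 : ℝ) : ℂ) ^ (-(s - 1)) *
      ((Real.exp (-((n : ℝ) + 1) * t) : ℝ) : ℂ)))
    (summable_rpow_mul_exp_neg (-(s - 1).re) (half_pos ht)) isOpen_Ioi
    (isPreconnected_Ioi (a := t / 2)) (fun n y _ => ?_) (fun n y hy => ?_)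
    (y₀ := t) (y := t) (by simpa using ht) (hasSum_polylogExp s ht).summable (by simpa using ht)
  · rw [tsum_neg] at key
    exact key
  · have h1 : HasDerivAt (fun y : ℝ => Real.exp (-((n : ℝ) + 1) * y))
        (Real.exp (-((n : ℝ) + 1) * y) * (-((n : ℝ) + 1))) y := by
      simpa using ((hasDerivAt_id y).const_mul (-((n : ℝ) + 1))).exp
    have h2 := h1.ofReal_comp.const_mul ((((n : ℝ) + 1 : ℝ) : ℂ) ^ (-s))
    refine h2.congr_deriv ?_
    have h0 : (((n : ℝ) + 1 : ℝ) : ℂ) ≠ 0 := by exact_mod_cast (by positivity : (n : ℝ) + 1 ≠ 0)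
    rw [show -(s - 1) = -s + 1 by ring, Complex.cpow_add _ _ h0, Complex.cpow_one]
    push_cast
    ring
  · rw [norm_neg, norm_polylogExp_term]
    have : t / 2 < y := hy
    have h3 : ((n : ℝ) + 1) * (t / 2) ≤ ((n : ℝ) + 1) * y := by gcongr
    gcongr ?_ * Real.exp ?_
    linarith

theorem continuousOn_polylogExp (s : ℂ) : ContinuousOn (polylogExp s) (Set.Ioi 0) :=
  fun _ ht => (hasDerivAt_polylogExp s ht).continuousAt.continuousWithinAt

/-! ### Euler's integral with a complex parameter -/

theorem integrableOn_rpow_mul_exp_neg_mul {σ r : ℝ} (hσ : 0 < σ) (hr : 0 < r) :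
    MeasureTheory.IntegrableOn (fun u : ℝ => u ^ (σ - 1) * Real.exp (-(r * u))) (Set.Ioi 0) := by
  have := integrableOn_rpow_mul_exp_neg_mul_rpow (p := 1) (s := σ - 1) (b := r) (by linarith)
    one_pos hr
  simpa only [Real.rpow_one, neg_mul] using this

theorem norm_cpow_mul_exp_neg_mul {u : ℝ} (hu : 0 < u) (a r : ℂ) :
    ‖(u : ℂ) ^ (a - 1) * Complex.exp (-(r * u))‖ =
      u ^ (a.re - 1) * Real.exp (-(r.re * u)) := by
  rw [norm_mul, Complex.norm_cpow_eq_rpow_re_of_pos hu, Complex.norm_exp]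
  simp

/-- Euler's integral `∫ u ^ (a - 1) * exp (-r * u) = Γ(a) * r ^ (-a)` for complex `r` in the right
half-plane. -/
theorem integral_cpow_mul_exp_neg_complex_mul_Ioi {a r : ℂ} (ha : 0 < a.re) (hr : 0 < r.re) :
    ∫ u : ℝ in Set.Ioi 0, (u : ℂ) ^ (a - 1) * Complex.exp (-(r * u)) =
      Complex.Gamma a * r ^ (-a) := by
  have hU : IsOpen {r : ℂ | 0 < r.re} := isOpen_lt continuous_const Complex.continuous_re
  have h1 : DifferentiableOn ℂ (fun r : ℂ =>
      ∫ u : ℝ in Set.Ioi 0, (u : ℂ) ^ (a - 1) * Complex.exp (-(r * u))) {r : ℂ | 0 < r.re} := by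
    refine differentiableOn_integral_of_locally_dominated hU (fun r _ => ?_)
      (MeasureTheory.ae_of_all _ fun u => by fun_prop) fun r₀ hr₀ => ?_
    · refine ContinuousOn.aestronglyMeasurable (fun u hu => ?_) measurableSet_Ioi
      have hu' : (u : ℂ) ∈ Complex.slitPlane := Complex.ofReal_mem_slitPlane.mpr hu
      exact ((Complex.continuous_ofReal.continuousAt.cpow continuousAt_const hu').mul
        (by fun_prop)).continuousWithinAt
    · have hr₀' : 0 < r₀.re := hr₀
      refine ⟨{r | r₀.re / 2 < r.re}, (isOpen_lt continuous_const
        Complex.continuous_re).mem_nhds (by simpa using hr₀), _,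
        integrableOn_rpow_mul_exp_neg_mul ha (half_pos hr₀'), ?_⟩
      filter_upwards [MeasureTheory.ae_restrict_mem measurableSet_Ioi] with u hu r hr
      have hu' : 0 < u := hu
      have hr' : r₀.re / 2 < r.re := hr
      rw [norm_cpow_mul_exp_neg_mul hu]
      gcongr
  have h2 : DifferentiableOn ℂ (fun r : ℂ => Complex.Gamma a * r ^ (-a)) {r : ℂ | 0 < r.re} :=
    fun r hr => ((differentiableAt_id.cpow_const (Or.inl hr)).const_mul _).differentiableWithinAt
  -- Both sides are holomorphic in `r` on the right half-plane and agree at the positive reals,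
  -- which accumulate at `1`.
  refine (h1.analyticOnNhd hU).eqOn_of_preconnected_of_frequently_eq (h2.analyticOnNhd hU)
    (convex_halfSpace_re_gt 0).isPreconnected (z₀ := 1) (by simp) ?_ hr
  have h3 : Tendsto (fun r : ℝ => (r : ℂ)) (𝓝[≠] 1) (𝓝[≠] 1) := by
    refine tendsto_nhdsWithin_iff.mpr
      ⟨(Complex.continuous_ofReal.tendsto' 1 1 (by simp)).mono_left nhdsWithin_le_nhds, ?_⟩
    filter_upwards [self_mem_nhdsWithin] with r hr
    simpa using hr
  refine h3.frequently (Eventually.frequently ?_)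
  filter_upwards [mem_nhdsWithin_of_mem_nhds (lt_mem_nhds one_pos)] with r hr
  rw [Complex.integral_cpow_mul_exp_neg_mul_Ioi ha hr, one_div, Complex.inv_cpow _ _
    (by rw [Complex.arg_ofReal_of_nonneg hr.le]; exact Real.pi_pos.ne), Complex.cpow_neg, mul_comm]

/-! ### Lipschitz summation formula -/

theorem two_pi_mul_abs_le_norm (t k : ℝ) :
    2 * Real.pi * |k| ≤ ‖(t : ℂ) + 2 * Real.pi * k * Complex.I‖ := by
  have h := Complex.abs_im_le_norm ((t : ℂ) + 2 * Real.pi * k * Complex.I)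
  have : ((t : ℂ) + 2 * Real.pi * k * Complex.I).im = 2 * Real.pi * k := by simp
  rwa [this, abs_mul, abs_of_pos Real.two_pi_pos] at h

/-- The base has modulus at least `2π|k|` and the exponent has nonpositive real part, so the bound
is free of `t`; the exponential factor pays for the argument of the base. -/
theorem norm_add_two_pi_mul_I_cpow_le (t : ℝ) {k : ℝ} (hk : k ≠ 0) {w : ℂ} (hw : w.re ≤ 0) :
    ‖((t : ℂ) + 2 * Real.pi * k * Complex.I) ^ w‖ ≤
      (2 * Real.pi * |k|) ^ w.re * Real.exp (Real.pi * |w.im|) := by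
  have hpos : 0 < 2 * Real.pi * |k| := mul_pos Real.two_pi_pos (abs_pos.mpr hk)
  refine (Complex.norm_cpow_le _ _).trans ?_
  rw [div_eq_mul_inv, ← Real.exp_neg]
  refine mul_le_mul (Real.rpow_le_rpow_of_nonpos hpos (two_pi_mul_abs_le_norm t k) hw)
    (Real.exp_le_exp.mpr ?_) (Real.exp_pos _).le (by positivity)
  refine (neg_le_abs _).trans ?_
  rw [abs_mul]
  exact mul_le_mul_of_nonneg_right (Complex.abs_arg_le_pi _) (abs_nonneg _)

theorem summable_two_pi_mul_rpow {c : ℝ} (hc : c < -1) :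
    Summable fun n : ℕ => (2 * Real.pi * ((n : ℝ) + 1)) ^ c := by
  have h := ((summable_nat_add_iff 1).mpr (Real.summable_nat_rpow.mpr hc)).mul_left
    ((2 * Real.pi) ^ c)
  refine h.congr fun n => ?_
  rw [Real.mul_rpow Real.two_pi_pos.le (by positivity)]
  push_cast
  rfl

theorem summable_add_two_pi_mul_I_cpow (t : ℝ) {w : ℂ} (hw : w.re < -1) :
    (Summable fun n : ℕ => ((t : ℂ) + 2 * Real.pi * ((n : ℝ) + 1 : ℝ) * Complex.I) ^ w) ∧
    Summable fun n : ℕ => ((t : ℂ) + 2 * Real.pi * (-((n : ℝ) + 1) : ℝ) * Complex.I) ^ w := by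
  have h := (summable_two_pi_mul_rpow hw).mul_right (Real.exp (Real.pi * |w.im|))
  constructor
  · refine .of_norm_bounded h fun n => ?_
    have := norm_add_two_pi_mul_I_cpow_le t (k := (n : ℝ) + 1) (by positivity) (w := w)
      (by linarith)
    rwa [abs_of_pos (by positivity : (0 : ℝ) < n + 1)] at this
  · refine .of_norm_bounded h fun n => ?_
    have := norm_add_two_pi_mul_I_cpow_le t (k := -((n : ℝ) + 1))
      (neg_ne_zero.mpr (by positivity)) (w := w) (by linarith)
    rwa [abs_neg, abs_of_pos (by positivity : (0 : ℝ) < n + 1)] at this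

/-- **Lipschitz summation formula** for complex exponents. -/
theorem polylogExp_eq_tsum_int {s : ℂ} (hs : s.re < 0) {t : ℝ} (ht : 0 < t) :
    polylogExp s t =
      ∑' k : ℤ, Complex.Gamma (1 - s) * ((t : ℂ) + 2 * Real.pi * (k : ℝ) * Complex.I) ^ (s - 1) := by
  -- This is `u ^ (-s) * exp (-tu)` extended by zero to `u ≤ 0`; the extension is continuous because
  -- `Re s < 0`.
  set f : ℝ → ℂ := fun u => ((max u 0 : ℝ) : ℂ) ^ (-s) * Complex.exp (-(t * u)) with hf
  have hs0 : -s ≠ 0 := fun h => by simp [neg_eq_zero.mp h] at hs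
  have hneg : ∀ u ≤ 0, f u = 0 := fun u hu => by
    simp [hf, max_eq_right hu, Complex.zero_cpow hs0]
  have hpos : ∀ u, 0 < u → f u = (u : ℂ) ^ ((1 - s) - 1) * Complex.exp (-(t * u)) := fun u hu => by
    simp only [hf, max_eq_left hu.le]
    ring_nf
  have hcont : Continuous f := by
    refine Continuous.mul ?_ (by fun_prop)
    exact (Complex.continuous_ofReal_cpow_const (by simpa using hs)).comp
      (continuous_id.max continuous_const)
  have hfourier : ∀ ξ : ℝ, FourierTransform.fourier f ξ =
      Complex.Gamma (1 - s) * ((t : ℂ) + 2 * Real.pi * ξ * Complex.I) ^ (s - 1) := by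
    intro ξ
    rw [Real.fourier_real_eq_integral_exp_smul,
      ← MeasureTheory.setIntegral_eq_integral_of_forall_compl_eq_zero (s := Set.Ioi 0)
        (fun u hu => by rw [hneg u (not_lt.mp hu), smul_zero]),
      show s - 1 = -(1 - s) by ring, ← integral_cpow_mul_exp_neg_complex_mul_Ioi
        (by simp; linarith) (by simpa using ht)]
    refine MeasureTheory.setIntegral_congr_fun measurableSet_Ioi fun u hu => ?_
    simp only [hpos u hu, smul_eq_mul]
    rw [mul_left_comm, ← Complex.exp_add]
    congr 2
    push_cast
    ring
  have hdecay : f =O[cocompact ℝ] fun u : ℝ => |u| ^ (-2 : ℝ) := by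
    rw [cocompact_eq_atBot_atTop, isBigO_sup]
    constructor
    · refine (IsBigO.of_bound 1 ?_)
      filter_upwards [eventually_le_atBot 0] with u hu
      rw [hneg u hu, norm_zero]
      positivity
    -- The exponent `Re s - 2` is chosen so that the product with `u ^ (-Re s)` decays like `u ^
    -- (-2)`, as Poisson summation is applied with exponent `2 > 1`.
    · have h1 := (isLittleO_exp_neg_mul_rpow_atTop ht (s.re - 2)).isBigO
      have h2 := (isBigO_refl (fun u : ℝ => u ^ (-s.re)) atTop).mul h1
      refine (IsBigO.of_norm_left (h2.congr' ?_ ?_))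
      · filter_upwards [eventually_gt_atTop 0] with u hu
        rw [hpos u hu, norm_cpow_mul_exp_neg_mul hu]
        simp
      · filter_upwards [eventually_gt_atTop 0] with u hu
        rw [← Real.rpow_add hu, abs_of_pos hu]
        ring_nf
  have hre : (s - 1).re < -1 := by simp; linarith
  obtain ⟨hsum₁, hsum₂⟩ := summable_add_two_pi_mul_I_cpow t hre
  have hsum : Summable fun n : ℤ => FourierTransform.fourier f n := by
    refine .of_add_one_of_neg_add_one ?_ ?_
    · refine (hsum₁.mul_left (Complex.Gamma (1 - s))).congr fun n => ?_
      rw [hfourier]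
      push_cast
      rfl
    · refine (hsum₂.mul_left (Complex.Gamma (1 - s))).congr fun n => ?_
      rw [hfourier]
      push_cast
      rfl
  have hpoisson := Real.tsum_eq_tsum_fourier_of_rpow_decay_of_summable hcont one_lt_two hdecay hsum 0
  have hL := hasSum_polylogExp s ht
  have hL' : HasSum (fun n : ℕ => f ((n + 1 : ℤ) : ℝ)) (polylogExp s t) := by
    refine hL.congr_fun fun n => ?_
    have : (0 : ℝ) < n + 1 := by positivity
    push_cast
    rw [hpos _ this]
    push_cast
    ring_nf
  have hR' : HasSum (fun n : ℕ => f ((-(n + 1) : ℤ) : ℝ)) 0 := by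
    refine hasSum_zero.congr_fun fun n => hneg _ ?_
    push_cast
    linarith [(Nat.cast_nonneg n : (0 : ℝ) ≤ n)]
  -- Over the integers only the positive ones contribute, so the left side of Poisson's formula is
  -- the polylogarithm.
  have hall := (hL'.of_add_one_of_neg_add_one (f := fun n : ℤ => f n) hR').tsum_eq
  simp only [Int.cast_zero, hneg 0 le_rfl, add_zero] at hall
  simp only [zero_add] at hpoisson
  rw [← hall, hpoisson]
  refine tsum_congr fun k => ?_
  rw [hfourier]
  simp

/-! ### The regular part at `t = 0` and its value `ζ(s)` -/

/-- The part of `polylogExp s t` that is smooth at `t = 0`. -/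
noncomputable def polylogReg (s : ℂ) (t : ℝ) : ℂ :=
  polylogExp s t - Complex.Gamma (1 - s) * (t : ℂ) ^ (s - 1)

/-- The frequency `0` term of the Lipschitz formula is exactly the singular part `Γ(1-s) t^(s-1)`;
the remaining frequencies are paired as `±(n + 1)`. -/
theorem polylogReg_eq_tsum {s : ℂ} (hs : s.re < 0) {t : ℝ} (ht : 0 < t) :
    polylogReg s t = Complex.Gamma (1 - s) *
      ∑' n : ℕ, (((t : ℂ) + 2 * Real.pi * ((n : ℝ) + 1 : ℝ) * Complex.I) ^ (s - 1) +
        ((t : ℂ) + 2 * Real.pi * (-((n : ℝ) + 1) : ℝ) * Complex.I) ^ (s - 1)) := by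
  have hre : (s - 1).re < -1 := by simp; linarith
  obtain ⟨h₁, h₂⟩ := summable_add_two_pi_mul_I_cpow t hre
  have h₁' := (h₁.hasSum.mul_left (Complex.Gamma (1 - s)))
  have h₂' := (h₂.hasSum.mul_left (Complex.Gamma (1 - s)))
  have h := HasSum.of_add_one_of_neg_add_one (f := fun k : ℤ => Complex.Gamma (1 - s) *
    ((t : ℂ) + 2 * Real.pi * (k : ℝ) * Complex.I) ^ (s - 1)) (m := _) (m' := _)
    (h₁'.congr_fun fun n => by push_cast; rfl) (h₂'.congr_fun fun n => by push_cast; rfl)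
  rw [polylogReg, polylogExp_eq_tsum_int hs ht, h.tsum_eq, h₁.tsum_add h₂]
  simp only [Int.cast_zero, Complex.ofReal_zero, mul_zero, zero_mul, add_zero]
  ring

theorem norm_polylogReg_summand_le {s : ℂ} (hs : s.re < 0) (t : ℝ) (n : ℕ) :
    ‖((t : ℂ) + 2 * Real.pi * ((n : ℝ) + 1 : ℝ) * Complex.I) ^ (s - 1) +
        ((t : ℂ) + 2 * Real.pi * (-((n : ℝ) + 1) : ℝ) * Complex.I) ^ (s - 1)‖ ≤
      (2 * Real.pi * ((n : ℝ) + 1)) ^ (s.re - 1) * (2 * Real.exp (Real.pi * |s.im|)) := by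
  have hn : (0 : ℝ) < n + 1 := by positivity
  have hre : (s - 1).re ≤ 0 := by simp; linarith
  have h₁ := norm_add_two_pi_mul_I_cpow_le t hn.ne' hre
  have h₂ := norm_add_two_pi_mul_I_cpow_le t (neg_ne_zero.mpr hn.ne') hre
  rw [abs_neg] at h₂
  rw [abs_of_pos hn] at h₁ h₂
  simp only [Complex.sub_re, Complex.one_re, Complex.sub_im, Complex.one_im, sub_zero] at h₁ h₂
  refine (norm_add_le _ _).trans ((add_le_add h₁ h₂).trans_eq ?_)
  ring

/-- The majorant of the Lipschitz series does not involve `t`, so one constant serves all `t > 0`.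
Replacing `Re s` by `Re s₀ / 2` and `|Im s|` by `|Im s₀| + 1` makes it uniform near `s₀`. -/
theorem exists_norm_polylogReg_le {s₀ : ℂ} (hs₀ : s₀.re < 0) :
    ∃ C : ℝ, ∀ᶠ s in 𝓝 s₀, ∀ t : ℝ, 0 < t → ‖polylogReg s t‖ ≤ C := by
  have hΓ : ContinuousAt (fun s : ℂ => ‖Complex.Gamma (1 - s)‖) s₀ := by
    refine (ContinuousAt.comp (x := s₀) (f := fun s : ℂ => 1 - s) (g := Complex.Gamma) ?_
      (by fun_prop)).norm
    refine (Complex.differentiableAt_Gamma _ fun m h => ?_).continuousAt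
    have := congrArg Complex.re h
    simp at this
    linarith [(Nat.cast_nonneg m : (0 : ℝ) ≤ m)]
  have hsum := (summable_two_pi_mul_rpow (c := s₀.re / 2 - 1) (by linarith)).mul_right
    (2 * Real.exp (Real.pi * (|s₀.im| + 1)))
  refine ⟨(‖Complex.Gamma (1 - s₀)‖ + 1) *
    ∑' n : ℕ, (2 * Real.pi * ((n : ℝ) + 1)) ^ (s₀.re / 2 - 1) *
      (2 * Real.exp (Real.pi * (|s₀.im| + 1))), ?_⟩
  have h1 : ∀ᶠ s in 𝓝 s₀, ‖Complex.Gamma (1 - s)‖ < ‖Complex.Gamma (1 - s₀)‖ + 1 :=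
    hΓ.eventually_lt_const (lt_add_one _)
  have h2 : ∀ᶠ s : ℂ in 𝓝 s₀, s.re < s₀.re / 2 :=
    Complex.continuous_re.continuousAt.eventually_lt_const (by linarith)
  have h3 : ∀ᶠ s : ℂ in 𝓝 s₀, |s.im| < |s₀.im| + 1 :=
    Complex.continuous_im.abs.continuousAt.eventually_lt_const (lt_add_one _)
  filter_upwards [h1, h2, h3] with s h1 h2 h3 t ht
  have hs : s.re < 0 := by linarith
  rw [polylogReg_eq_tsum hs ht, norm_mul]
  refine mul_le_mul h1.le (tsum_of_norm_bounded hsum.hasSum fun n => ?_) (norm_nonneg _)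
    (by positivity)
  refine (norm_polylogReg_summand_le hs t n).trans ?_
  have h4 : 1 ≤ 2 * Real.pi * ((n : ℝ) + 1) := by
    nlinarith [Real.pi_gt_three, (Nat.cast_nonneg n : (0 : ℝ) ≤ n)]
  gcongr

/-- Dominated convergence allows `t = 0` in each term. Since `i^(s-1) + (-i)^(s-1) = 2
cos(π(1-s)/2)`, the limit is the right side of the functional equation for `ζ(s)`. -/
theorem tendsto_polylogReg_of_re_neg {s : ℂ} (hs : s.re < 0) :
    Tendsto (polylogReg s) (𝓝[>] 0) (𝓝 (riemannZeta s)) := by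
  have hsum := (summable_two_pi_mul_rpow (c := s.re - 1) (by linarith)).mul_right
    (2 * Real.exp (Real.pi * |s.im|))
  have hterm : ∀ k : ℝ, k ≠ 0 → Tendsto (fun t : ℝ =>
      ((t : ℂ) + 2 * Real.pi * k * Complex.I) ^ (s - 1)) (𝓝[>] 0)
        (𝓝 ((2 * Real.pi * k * Complex.I) ^ (s - 1))) := by
    intro k hk
    have hc : ContinuousAt (fun t : ℝ => ((t : ℂ) + 2 * Real.pi * k * Complex.I) ^ (s - 1)) 0 := by
      refine ContinuousAt.cpow (by fun_prop) continuousAt_const (Or.inr ?_)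
      simpa using hk
    simpa using hc.tendsto.mono_left nhdsWithin_le_nhds
  have hlim := (tendsto_tsum_of_dominated_convergence hsum
    (fun n : ℕ => (hterm ((n : ℝ) + 1) (by positivity)).add
      (hterm (-((n : ℝ) + 1)) (neg_ne_zero.mpr (by positivity))))
    (Eventually.of_forall fun t n => norm_polylogReg_summand_le hs t n)).const_mul
      (Complex.Gamma (1 - s))
  have hval : riemannZeta s = Complex.Gamma (1 - s) * ∑' n : ℕ,
      ((2 * Real.pi * ((n : ℝ) + 1 : ℝ) * Complex.I) ^ (s - 1) +
        (2 * Real.pi * (-((n : ℝ) + 1) : ℝ) * Complex.I) ^ (s - 1)) := by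
    have hfe := riemannZeta_one_sub (s := 1 - s) (fun n h => by
      have := congrArg Complex.re h
      simp at this
      linarith [(Nat.cast_nonneg n : (0 : ℝ) ≤ n)]) (fun h => by
      have := congrArg Complex.re h
      simp at this
      linarith)
    rw [sub_sub_cancel, zeta_eq_tsum_one_div_nat_add_one_cpow (s := 1 - s)
      (by simp only [Complex.sub_re, Complex.one_re]; linarith)] at hfe
    have hpow : ∀ n : ℕ, (2 * Real.pi * ((n : ℝ) + 1 : ℝ) * Complex.I) ^ (s - 1) +
        (2 * Real.pi * (-((n : ℝ) + 1) : ℝ) * Complex.I) ^ (s - 1) =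
        (2 * (2 * Real.pi) ^ (-(1 - s)) * Complex.cos (Real.pi * (1 - s) / 2)) *
          (1 / ((n : ℂ) + 1) ^ (1 - s)) := by
      intro n
      have hn : (0 : ℝ) < n + 1 := by positivity
      have h2 : (0 : ℝ) < 2 * Real.pi * (n + 1) := by positivity
      have hn0 : ((n : ℂ) + 1) ≠ 0 := by exact_mod_cast hn.ne'
      have hp0 : (2 * (Real.pi : ℂ)) ≠ 0 := by exact_mod_cast Real.two_pi_pos.ne'
      have e1 : (2 * Real.pi * ((n : ℝ) + 1 : ℝ) * Complex.I : ℂ) =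
          ((2 * Real.pi * (n + 1) : ℝ) : ℂ) * Complex.I := by push_cast; ring
      have e2 : (2 * Real.pi * (-((n : ℝ) + 1) : ℝ) * Complex.I : ℂ) =
          ((2 * Real.pi * (n + 1) : ℝ) : ℂ) * (-Complex.I) := by push_cast; ring
      have hI : ((2 * Real.pi * (n + 1) : ℝ) : ℂ) ≠ 0 := by exact_mod_cast h2.ne'
      have el : ((Real.log (2 * Real.pi * (n + 1)) : ℝ) : ℂ) =
          Complex.log (2 * Real.pi) + Complex.log ((n : ℂ) + 1) := by
        rw [Real.log_mul Real.two_pi_pos.ne' hn.ne', Complex.ofReal_add,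
          Complex.ofReal_log Real.two_pi_pos.le, Complex.ofReal_log hn.le]
        push_cast
        rfl
      rw [e1, e2, Complex.cpow_def_of_ne_zero (mul_ne_zero hI Complex.I_ne_zero),
        Complex.cpow_def_of_ne_zero (mul_ne_zero hI (neg_ne_zero.mpr Complex.I_ne_zero)),
        Complex.log_ofReal_mul h2 Complex.I_ne_zero,
        Complex.log_ofReal_mul h2 (neg_ne_zero.mpr Complex.I_ne_zero), Complex.log_I,
        Complex.log_neg_I, one_div, ← Complex.cpow_neg, Complex.cpow_def_of_ne_zero hn0,
        Complex.cpow_def_of_ne_zero hp0, Complex.cos, el]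
      rw [show ∀ a b c d : ℂ, 2 * a * ((b + c) / 2) * d = a * d * c + a * d * b by intros; ring,
        ← Complex.exp_add, ← Complex.exp_add, ← Complex.exp_add]
      congr 2 <;> ring
    rw [tsum_congr hpow, tsum_mul_left, hfe]
    ring
  rw [hval]
  refine hlim.congr' ?_
  filter_upwards [self_mem_nhdsWithin] with t ht
  exact (polylogReg_eq_tsum hs ht).symm

/-- The subtracted singular parts obey the same derivative relation, because `Γ(2-s) = (1-s)
Γ(1-s)`. -/
theorem hasDerivAt_polylogReg {s : ℂ} (hs : s ≠ 1) {t : ℝ} (ht : 0 < t) :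
    HasDerivAt (polylogReg s) (-polylogReg (s - 1) t) t := by
  have h1 : HasDerivAt (fun t : ℝ => (t : ℂ) ^ (s - 1)) ((s - 1) * (t : ℂ) ^ (s - 1 - 1)) t :=
    hasDerivAt_ofReal_cpow_const ht.ne' (sub_ne_zero.mpr hs)
  refine ((hasDerivAt_polylogExp s ht).sub (h1.const_mul _)).congr_deriv ?_
  rw [polylogReg, show 1 - (s - 1) = (1 - s) + 1 by ring,
    Complex.Gamma_add_one _ (sub_ne_zero.mpr hs.symm)]
  ring

theorem continuousOn_polylogReg (s : ℂ) : ContinuousOn (polylogReg s) (Set.Ioi 0) := by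
  refine (continuousOn_polylogExp s).sub (continuousOn_const.mul fun t ht => ?_)
  have ht' : (t : ℂ) ∈ Complex.slitPlane := Complex.ofReal_mem_slitPlane.mpr ht
  exact (Complex.continuous_ofReal.continuousAt.cpow continuousAt_const ht').continuousWithinAt

theorem differentiableAt_Gamma_one_sub {s : ℂ} (hs : s.re < 1) :
    DifferentiableAt ℂ (fun s => Complex.Gamma (1 - s)) s := by
  refine DifferentiableAt.comp s (Complex.differentiableAt_Gamma _ fun m h => ?_) (by fun_prop)
  have := congrArg Complex.re h
  simp at this
  linarith [(Nat.cast_nonneg m : (0 : ℝ) ≤ m)]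

theorem differentiableOn_polylogReg {t : ℝ} (ht : 0 < t) :
    DifferentiableOn ℂ (fun s => polylogReg s t) {s : ℂ | s.re < 1} := by
  intro s hs
  refine (((differentiable_polylogExp ht) s).sub ((differentiableAt_Gamma_one_sub hs).mul
    ?_)).differentiableWithinAt
  exact (differentiableAt_id.sub_const 1).const_cpow (Or.inl (by exact_mod_cast ht.ne'))

theorem exists_norm_polylogReg_sub_one_le {s₀ : ℂ} (hs₀ : s₀.re < 1) :
    ∃ C : ℝ, ∀ᶠ s in 𝓝 s₀, ∀ t : ℝ, 0 < t → ‖polylogReg (s - 1) t‖ ≤ C := by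
  obtain ⟨C, hC⟩ := exists_norm_polylogReg_le (s₀ := s₀ - 1) (by simpa using hs₀)
  exact ⟨C, (tendsto_id.sub_const 1).eventually hC⟩

theorem intervalIntegrable_polylogReg {s : ℂ} (hs : s.re < 0) {a b : ℝ} (ha : 0 ≤ a)
    (hb : 0 ≤ b) : IntervalIntegrable (polylogReg s) MeasureTheory.volume a b := by
  obtain ⟨C, hC⟩ := exists_norm_polylogReg_le hs
  have hmeas : MeasureTheory.AEStronglyMeasurable (polylogReg s)
      (MeasureTheory.volume.restrict (Set.uIoc a b)) :=
    ((continuousOn_polylogReg s).aestronglyMeasurable measurableSet_Ioi).mono_set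
      fun t ht => (le_min ha hb).trans_lt ht.1
  refine (intervalIntegrable_const (c := C)).mono_fun' hmeas ?_
  filter_upwards [MeasureTheory.ae_restrict_mem measurableSet_uIoc] with t ht
  exact hC.self_of_nhds t ((le_min ha hb).trans_lt ht.1)

/-- The value at `t = 0` of `polylogReg s` is `ζ(s)`. -/
theorem tendsto_polylogReg {s : ℂ} (hs : s.re < 1) :
    Tendsto (polylogReg s) (𝓝[>] 0) (𝓝 (riemannZeta s)) := by
  set U : Set ℂ := {s : ℂ | s.re < 1} with hUdef
  have hU : IsOpen U := isOpen_lt Complex.continuous_re continuous_const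
  -- The limit at `0` obtained by integrating the derivative over `(0, 1]`; the integrand has order
  -- `s - 1`, whose real part is negative, so it is bounded.
  set c : ℂ → ℂ := fun s => polylogReg s 1 + ∫ t in (0 : ℝ)..1, polylogReg (s - 1) t with hc
  have hne : ∀ s ∈ U, s ≠ 1 := fun s hs h => by simp [hUdef, h] at hs
  have hlim : ∀ s ∈ U, Tendsto (polylogReg s) (𝓝[>] 0) (𝓝 (c s)) := by
    intro s hs
    have hs1 : (s - 1).re < 0 := by simpa using (show s.re < 1 from hs)
    obtain ⟨C, hC⟩ := exists_norm_polylogReg_sub_one_le (show s.re < 1 from hs)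
    rw [tendsto_iff_norm_sub_tendsto_zero]
    have h0 : Tendsto (fun t : ℝ => C * |t - 0|) (𝓝[>] 0) (𝓝 0) := by
      have : Continuous fun t : ℝ => C * |t - 0| := by fun_prop
      exact (this.tendsto' 0 0 (by simp)).mono_left nhdsWithin_le_nhds
    refine squeeze_zero' (Eventually.of_forall fun t => norm_nonneg _) ?_ h0
    filter_upwards [self_mem_nhdsWithin, mem_nhdsWithin_of_mem_nhds (gt_mem_nhds one_pos)]
      with t ht ht1
    have ht' : 0 < t := ht
    have hftc : ∫ u in t..1, -polylogReg (s - 1) u = polylogReg s 1 - polylogReg s t := by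
      refine intervalIntegral.integral_eq_sub_of_hasDerivAt (fun u hu => ?_)
        (intervalIntegrable_polylogReg hs1 ht'.le zero_le_one).neg
      exact hasDerivAt_polylogReg (hne s hs) ((lt_min ht' one_pos).trans_le hu.1)
    have hsplit := intervalIntegral.integral_add_adjacent_intervals
      (intervalIntegrable_polylogReg hs1 le_rfl ht'.le)
      (intervalIntegrable_polylogReg hs1 ht'.le zero_le_one)
    rw [intervalIntegral.integral_neg] at hftc
    have : polylogReg s t - c s = -∫ u in (0 : ℝ)..t, polylogReg (s - 1) u := by
      rw [hc]
      linear_combination hsplit + hftc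
    rw [this, norm_neg]
    refine intervalIntegral.norm_integral_le_of_norm_le_const fun u hu => ?_
    exact hC.self_of_nhds u ((le_min le_rfl ht'.le).trans_lt hu.1)
  have hcdiff : DifferentiableOn ℂ c U := by
    refine (differentiableOn_polylogReg one_pos).add ?_
    simp only [intervalIntegral.integral_of_le zero_le_one]
    refine differentiableOn_integral_of_locally_dominated hU (fun s hs => ?_) ?_ fun s₀ hs₀ => ?_
    · exact ((continuousOn_polylogReg (s - 1)).aestronglyMeasurable measurableSet_Ioi).mono_set
        Set.Ioc_subset_Ioi_self
    · filter_upwards [MeasureTheory.ae_restrict_mem measurableSet_Ioc] with t ht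
      refine (differentiableOn_polylogReg ht.1).comp (by fun_prop) fun s hs => ?_
      have : s.re < 1 := hs
      simp only [Set.mem_ofPred_eq, Complex.sub_re, Complex.one_re]
      linarith
    · obtain ⟨C, hC⟩ := exists_norm_polylogReg_sub_one_le (show s₀.re < 1 from hs₀)
      refine ⟨_, hC, fun _ => C, MeasureTheory.integrable_const C, ?_⟩
      filter_upwards [MeasureTheory.ae_restrict_mem measurableSet_Ioc] with t ht s hs
      exact hs t ht.1
  have hζ : DifferentiableOn ℂ riemannZeta U := fun s hs =>
    (differentiableAt_riemannZeta (hne s hs)).differentiableWithinAt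
  -- The two functions agree for `Re s < 0` by the Lipschitz computation, hence on the half-plane
  -- `Re s < 1` by the identity theorem.
  have heq : Set.EqOn c riemannZeta U := by
    refine (hcdiff.analyticOnNhd hU).eqOn_of_preconnected_of_eventuallyEq (hζ.analyticOnNhd hU)
      (convex_halfSpace_re_lt 1).isPreconnected (z₀ := -1) (by simp [hUdef]) ?_
    filter_upwards [(isOpen_lt Complex.continuous_re continuous_const).mem_nhds
      (show (-1 : ℂ).re < 0 by simp)] with s hs
    have hs' : s.re < 0 := hs
    exact tendsto_nhds_unique (hlim s (by simp only [hUdef, Set.mem_ofPred_eq]; linarith))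
      (tendsto_polylogReg_of_re_neg hs')
  rw [← heq hs]
  exact hlim s hs

/-! ### Taylor remainders of the regular part -/

/-- The remainder of order `K` in the expansion of `polylogReg s` at `t = 0`. -/
noncomputable def polylogRem (K : ℕ) (s : ℂ) (t : ℝ) : ℂ :=
  polylogReg s t - ∑ k ∈ Finset.range K, riemannZeta (s - k) * ((-t) ^ k / k.factorial)

/-- Differentiation drops the constant term and turns the coefficient `ζ(s-(k+1))` into
`ζ((s-1)-k)`. A bound of order `K` at `s - 1` therefore integrates to one of order `K + 1` at `s`.
-/
theorem hasDerivAt_polylogRem_succ (K : ℕ) {s : ℂ} (hs : s ≠ 1) {t : ℝ} (ht : 0 < t) :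
    HasDerivAt (polylogRem (K + 1) s) (-polylogRem K (s - 1) t) t := by
  have hsum : HasDerivAt (fun t : ℝ => ∑ k ∈ Finset.range (K + 1),
      riemannZeta (s - k) * ((-(t : ℂ)) ^ k / k.factorial))
      (∑ k ∈ Finset.range K, -(riemannZeta (s - 1 - k) * ((-(t : ℂ)) ^ k / k.factorial))) t := by
    have hterm : ∀ k ∈ Finset.range (K + 1), HasDerivAt
        (fun t : ℝ => riemannZeta (s - k) * ((-(t : ℂ)) ^ k / k.factorial))
        (riemannZeta (s - k) * (k * (-(t : ℂ)) ^ (k - 1) * (-1) / k.factorial)) t := fun k _ => by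
      have h := (((Complex.ofRealCLM.hasDerivAt (x := t)).neg).pow k).div_const (k.factorial : ℂ)
      simpa using h.const_mul (riemannZeta (s - k))
    refine (HasDerivAt.fun_sum hterm).congr_deriv ?_
    rw [Finset.sum_range_succ']
    simp only [Nat.cast_zero, zero_mul, zero_div, mul_zero, add_zero]
    refine Finset.sum_congr rfl fun k _ => ?_
    have hk : ((k : ℂ) + 1) ≠ 0 := by exact_mod_cast k.succ_ne_zero
    have hk' : (k.factorial : ℂ) ≠ 0 := by exact_mod_cast k.factorial_ne_zero
    rw [Nat.factorial_succ, Nat.add_sub_cancel]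
    push_cast
    rw [show s - ((k : ℂ) + 1) = s - 1 - k by ring]
    field_simp
  refine ((hasDerivAt_polylogReg hs ht).sub hsum).congr_deriv ?_
  rw [Finset.sum_neg_distrib, polylogRem]
  ring

theorem tendsto_polylogRem_succ (K : ℕ) {s : ℂ} (hs : s.re < 1) :
    Tendsto (polylogRem (K + 1) s) (𝓝[>] 0) (𝓝 0) := by
  have h1 : Continuous fun t : ℝ => ∑ k ∈ Finset.range (K + 1),
      riemannZeta (s - k) * ((-(t : ℂ)) ^ k / k.factorial) := by fun_prop
  have h2 := (tendsto_polylogReg hs).sub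
    ((h1.tendsto' 0 (riemannZeta s) ?_).mono_left nhdsWithin_le_nhds)
  · rw [sub_self] at h2
    exact h2
  · rw [Finset.sum_range_succ']
    simp

/-- Mean value inequality on `[ε, t]`, then `ε → 0`. The crude bound `t * t ^ K` suffices. -/
theorem norm_le_mul_pow_succ_of_hasDerivAt {E : Type*} [NormedAddCommGroup E] [NormedSpace ℝ E]
    {h h' : ℝ → E} {C : ℝ} {K : ℕ} (hC : 0 ≤ C) (hderiv : ∀ t, 0 < t → HasDerivAt h (h' t) t)
    (hbound : ∀ t, 0 < t → ‖h' t‖ ≤ C * t ^ K) (hlim : Tendsto h (𝓝[>] 0) (𝓝 0)) {t : ℝ}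
    (ht : 0 < t) : ‖h t‖ ≤ C * t ^ (K + 1) := by
  have h1 : ∀ᶠ ε in 𝓝[>] (0 : ℝ), ‖h t - h ε‖ ≤ C * t ^ (K + 1) := by
    filter_upwards [self_mem_nhdsWithin, mem_nhdsWithin_of_mem_nhds (gt_mem_nhds ht)] with ε hε hεt
    have hε' : 0 < ε := hε
    have := (convex_Icc ε t).norm_image_sub_le_of_norm_hasDerivWithin_le (f := h) (f' := h')
      (C := C * t ^ K)
      (fun u hu => (hderiv u (hε'.trans_le hu.1)).hasDerivWithinAt)
      (fun u hu => (hbound u (hε'.trans_le hu.1)).trans (by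
        have := (hε'.trans_le hu.1).le
        have := hu.2
        gcongr))
      (Set.left_mem_Icc.mpr hεt.le) (Set.right_mem_Icc.mpr hεt.le)
    refine this.trans ?_
    rw [Real.norm_of_nonneg (by linarith), pow_succ, ← mul_assoc]
    gcongr
    linarith
  have h2 := ((tendsto_const_nhds (x := h t)).sub hlim).norm
  rw [sub_zero] at h2
  exact le_of_tendsto h2 h1

/-- Induction on `K`: passing to `s - 1` stays in the half-plane `Re s < 0`, where the case `K = 0`
is the uniform bound for the regular part. -/
theorem exists_norm_polylogRem_le_of_re_neg (K : ℕ) {s₀ : ℂ} (hs₀ : s₀.re < 0) :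
    ∃ C : ℝ, 0 ≤ C ∧ ∀ᶠ s in 𝓝 s₀, ∀ t : ℝ, 0 < t → ‖polylogRem K s t‖ ≤ C * t ^ K := by
  induction K generalizing s₀ with
  | zero =>
    obtain ⟨C, hC⟩ := exists_norm_polylogReg_le hs₀
    refine ⟨C, (norm_nonneg _).trans (hC.self_of_nhds 1 one_pos), ?_⟩
    simpa [polylogRem] using hC
  | succ K ih =>
    obtain ⟨C, hC0, hC⟩ := ih (s₀ := s₀ - 1) (by simp; linarith)
    refine ⟨C, hC0, ?_⟩
    have hlt : ∀ᶠ s : ℂ in 𝓝 s₀, s.re < 0 :=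
      Complex.continuous_re.continuousAt.eventually_lt_const hs₀
    filter_upwards [(tendsto_id.sub_const 1).eventually hC, hlt] with s hs hs1 t ht
    refine norm_le_mul_pow_succ_of_hasDerivAt hC0
      (fun t ht => hasDerivAt_polylogRem_succ K (fun h => ?_) ht)
      (fun t ht => by simpa using hs t ht) (tendsto_polylogRem_succ K (by linarith)) ht
    norm_num [h] at hs1

/-- The remainder of positive order is `O(t ^ K)`, uniformly for all `t > 0` and locally uniformly
for `Re s < 1`. -/
theorem exists_norm_polylogRem_succ_le (K : ℕ) {s₀ : ℂ} (hs₀ : s₀.re < 1) :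
    ∃ C : ℝ, 0 ≤ C ∧
      ∀ᶠ s in 𝓝 s₀, ∀ t : ℝ, 0 < t → ‖polylogRem (K + 1) s t‖ ≤ C * t ^ (K + 1) := by
  obtain ⟨C, hC0, hC⟩ := exists_norm_polylogRem_le_of_re_neg K (s₀ := s₀ - 1) (by simpa using hs₀)
  refine ⟨C, hC0, ?_⟩
  have hlt : ∀ᶠ s : ℂ in 𝓝 s₀, s.re < 1 :=
    Complex.continuous_re.continuousAt.eventually_lt_const hs₀
  filter_upwards [(tendsto_id.sub_const 1).eventually hC, hlt] with s hs hs1 t ht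
  refine norm_le_mul_pow_succ_of_hasDerivAt hC0
    (fun t ht => hasDerivAt_polylogRem_succ K (fun h => ?_) ht)
    (fun t ht => by simpa using hs t ht) (tendsto_polylogRem_succ K hs1) ht
  norm_num [h] at hs1

theorem continuousOn_polylogRem (K : ℕ) (s : ℂ) : ContinuousOn (polylogRem K s) (Set.Ioi 0) :=
  (continuousOn_polylogReg s).sub (Continuous.continuousOn (by fun_prop))

theorem differentiableOn_polylogRem (K : ℕ) {t : ℝ} (ht : 0 < t) :
    DifferentiableOn ℂ (fun s => polylogRem K s t) {s : ℂ | s.re < 1} := by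
  refine (differentiableOn_polylogReg ht).sub (DifferentiableOn.fun_sum fun k _ => ?_)
  refine DifferentiableOn.mul_const (fun s hs => ?_) _
  have hs' : s.re < 1 := hs
  refine (DifferentiableAt.comp s (differentiableAt_riemannZeta fun h => ?_)
    (by fun_prop)).differentiableWithinAt
  have := congrArg Complex.re h
  simp at this
  linarith [(Nat.cast_nonneg k : (0 : ℝ) ≤ k)]

/-! ### The double series and its Mellin representation -/

section ThetaSeries

variable {x : ℝ}

theorem thetaTerm_eq_inv_cpow (x : ℝ) (s : ℂ) (p : ℕ × ℕ) :
    thetaTerm s s s x p = (((p.1 : ℝ) + 1 : ℝ) : ℂ) ^ (-s) * (((p.2 : ℝ) + 1 : ℝ) : ℂ) ^ (-s) /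
      ((((p.1 : ℝ) + 1) + ((p.2 : ℝ) + 1) * x : ℝ) : ℂ) ^ s := by
  rw [thetaTerm, Complex.cpow_neg, Complex.cpow_neg]
  field_simp

theorem norm_thetaTerm (hx : 0 < x) (s : ℂ) (p : ℕ × ℕ) :
    ‖thetaTerm s s s x p‖ = ((p.1 : ℝ) + 1) ^ (-s.re) * ((p.2 : ℝ) + 1) ^ (-s.re) /
      (((p.1 : ℝ) + 1) + ((p.2 : ℝ) + 1) * x) ^ s.re := by
  rw [thetaTerm_eq_inv_cpow, norm_div, norm_mul, norm_natCast_add_one_cpow,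
    norm_natCast_add_one_cpow, Complex.norm_cpow_eq_rpow_re_of_pos (by positivity), Complex.neg_re]

theorem norm_thetaTerm_anti (hx : 0 < x) {σ : ℝ} {s : ℂ} (hs : σ ≤ s.re)
    (p : ℕ × ℕ) : ‖thetaTerm s s s x p‖ ≤ ‖thetaTerm σ σ σ x p‖ := by
  rw [norm_thetaTerm hx, norm_thetaTerm hx, Complex.ofReal_re]
  have h1 : (0 : ℝ) ≤ p.1 := Nat.cast_nonneg _
  have h2 : (0 : ℝ) ≤ p.2 := Nat.cast_nonneg _
  have h3 : 0 ≤ ((p.2 : ℝ) + 1) * x := by positivity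
  gcongr <;> linarith

/-- The double series converges absolutely for `2 / 3 < Re s`. -/
theorem summable_norm_thetaTerm (hx : 0 < x) {s : ℂ} (hs : 2 / 3 < s.re) :
    Summable fun p : ℕ × ℕ => ‖thetaTerm s s s x p‖ := by
  have h1 : Summable fun n : ℕ => ((n : ℝ) + 1) ^ (-(3 / 2 * s.re)) := by
    have := (summable_nat_add_iff 1).mpr
      (Real.summable_nat_rpow (p := -(3 / 2 * s.re)) |>.mpr (by linarith))
    simpa using this
  have h2 := (h1.mul_of_nonneg h1 (fun n => by positivity) (fun n => by positivity)).mul_left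
    ((2 * √x) ^ (-s.re))
  refine h2.of_nonneg_of_le (fun p => norm_nonneg _) fun p => ?_
  have ha : (0 : ℝ) < p.1 + 1 := by positivity
  have hb : (0 : ℝ) < p.2 + 1 := by positivity
  rw [norm_thetaTerm hx]
  set a : ℝ := p.1 + 1
  set b : ℝ := p.2 + 1
  -- AM-GM splits the mixed factor evenly between `n` and `m`, leaving `(nm)^(-3σ/2)`; the condition
  -- `3σ/2 > 1` is the threshold `2/3`.
  have hamgm : 2 * √x * (√a * √b) ≤ a + b * x := by
    have e1 := Real.sq_sqrt ha.le
    have e2 := Real.sq_sqrt hb.le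
    have e3 := Real.sq_sqrt hx.le
    nlinarith [sq_nonneg (√a - √b * √x)]
  have hsx := Real.sqrt_pos.mpr hx
  have hsa := Real.sqrt_pos.mpr ha
  have hsb := Real.sqrt_pos.mpr hb
  have hle : (2 * √x * (√a * √b)) ^ s.re ≤ (a + b * x) ^ s.re :=
    Real.rpow_le_rpow (by positivity) hamgm (by linarith)
  calc a ^ (-s.re) * b ^ (-s.re) / (a + b * x) ^ s.re
      ≤ a ^ (-s.re) * b ^ (-s.re) / (2 * √x * (√a * √b)) ^ s.re := by gcongr
    _ = (2 * √x) ^ (-s.re) * (a ^ (-(3 / 2 * s.re)) * b ^ (-(3 / 2 * s.re))) := by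
        rw [Real.mul_rpow (by positivity) (by positivity), Real.mul_rpow hsa.le hsb.le,
          Real.sqrt_eq_rpow a, Real.sqrt_eq_rpow b, ← Real.rpow_mul ha.le, ← Real.rpow_mul hb.le,
          Real.rpow_neg (by positivity : 0 ≤ 2 * √x),
          show -(3 / 2 * s.re) = -s.re + -(1 / 2 * s.re) by ring, Real.rpow_add ha,
          Real.rpow_add hb, Real.rpow_neg ha.le (1 / 2 * s.re), Real.rpow_neg hb.le (1 / 2 * s.re)]
        field_simp

theorem differentiableOn_thetaSeries (hx : 0 < x) :
    DifferentiableOn ℂ (fun s => thetaSeries s s s x) {s : ℂ | 2 / 3 < s.re} := by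
  intro s₀ hs₀
  have hs₀' : 2 / 3 < s₀.re := hs₀
  set σ : ℝ := (2 / 3 + s₀.re) / 2 with hσ
  have hU : IsOpen {s : ℂ | σ < s.re} := isOpen_lt continuous_const Complex.continuous_re
  refine ((Complex.differentiableOn_tsum_of_summable_norm
    (summable_norm_thetaTerm hx (s := (σ : ℂ)) ?_) (fun p => ?_) hU
    fun p s hs => norm_thetaTerm_anti hx (le_of_lt hs) p).differentiableAt
      (hU.mem_nhds ?_)).differentiableWithinAt
  · rw [Complex.ofReal_re]
    linarith
  · have ha : (((p.1 : ℝ) + 1 : ℝ) : ℂ) ≠ 0 := by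
      exact_mod_cast (by positivity : (p.1 : ℝ) + 1 ≠ 0)
    have hb : (((p.2 : ℝ) + 1 : ℝ) : ℂ) ≠ 0 := by
      exact_mod_cast (by positivity : (p.2 : ℝ) + 1 ≠ 0)
    have hc : ((((p.1 : ℝ) + 1) + ((p.2 : ℝ) + 1) * x : ℝ) : ℂ) ≠ 0 := by
      exact_mod_cast (by positivity : ((p.1 : ℝ) + 1) + ((p.2 : ℝ) + 1) * x ≠ 0)
    have hid : Differentiable ℂ fun s : ℂ => s := differentiable_id
    refine Differentiable.differentiableOn (Differentiable.div (differentiable_const _)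
      (((hid.const_cpow (Or.inl ha)).mul (hid.const_cpow (Or.inl hb))).mul
        (hid.const_cpow (Or.inl hc))) fun s => ?_)
    exact mul_ne_zero (mul_ne_zero (fun h => ha ((Complex.cpow_eq_zero_iff _ _).mp h).1)
      fun h => hb ((Complex.cpow_eq_zero_iff _ _).mp h).1)
      fun h => hc ((Complex.cpow_eq_zero_iff _ _).mp h).1
  · show σ < s₀.re
    linarith

theorem hasSum_mul_of_summable_norm {ι κ : Type*} {f : ι → ℂ} {g : κ → ℂ} {a b : ℂ}
    (hf : HasSum f a) (hg : HasSum g b) (hf' : Summable fun i => ‖f i‖)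
    (hg' : Summable fun i => ‖g i‖) : HasSum (fun p : ι × κ => f p.1 * g p.2) (a * b) :=
  hf.mul hg (summable_mul_of_summable_norm hf' hg')

theorem hasSum_polylogExp_mul (hx : 0 < x) (s : ℂ) {t : ℝ} (ht : 0 < t) :
    HasSum (fun p : ℕ × ℕ =>
      ((((p.1 : ℝ) + 1 : ℝ) : ℂ) ^ (-s) * (((p.2 : ℝ) + 1 : ℝ) : ℂ) ^ (-s)) *
        ((Real.exp (-(((p.1 : ℝ) + 1) + ((p.2 : ℝ) + 1) * x) * t) : ℝ) : ℂ))
      (polylogExp s t * polylogExp s (x * t)) := by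
  have hnorm : ∀ t : ℝ, 0 < t → Summable fun n : ℕ => ‖(((n : ℝ) + 1 : ℝ) : ℂ) ^ (-s) *
      ((Real.exp (-((n : ℝ) + 1) * t) : ℝ) : ℂ)‖ := fun t ht => by
    simpa only [norm_polylogExp_term] using summable_rpow_mul_exp_neg (-s.re) ht
  refine (hasSum_mul_of_summable_norm (hasSum_polylogExp s ht)
    (hasSum_polylogExp s (mul_pos hx ht)) (hnorm t ht) (hnorm _ (mul_pos hx ht))).congr_fun
      fun p => ?_
  have he : Real.exp (-(((p.1 : ℝ) + 1) + ((p.2 : ℝ) + 1) * x) * t) =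
      Real.exp (-((p.1 : ℝ) + 1) * t) * Real.exp (-((p.2 : ℝ) + 1) * (x * t)) := by
    rw [← Real.exp_add]
    ring_nf
  rw [he, Complex.ofReal_mul, mul_mul_mul_comm]

/-- The product of the two series is a sum of exponentials with rates `n + mx`, and each integrates
to `Γ(s) (n + mx)^(-s)`. -/
theorem mellin_polylogExp_mul (hx : 0 < x) {s : ℂ} (hs : 2 / 3 < s.re) :
    mellin (fun t => polylogExp s t * polylogExp s (x * t)) s =
      Complex.Gamma s * thetaSeries s s s x := by
  have h := hasSum_mellin (s := s)
    (a := fun p : ℕ × ℕ => (((p.1 : ℝ) + 1 : ℝ) : ℂ) ^ (-s) * (((p.2 : ℝ) + 1 : ℝ) : ℂ) ^ (-s))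
    (p := fun p : ℕ × ℕ => ((p.1 : ℝ) + 1) + ((p.2 : ℝ) + 1) * x)
    (fun p => Or.inr (by positivity)) (by linarith)
    (fun t ht => hasSum_polylogExp_mul hx s ht) ?_
  · rw [← h.tsum_eq, thetaSeries, ← tsum_mul_left]
    refine tsum_congr fun p => ?_
    rw [thetaTerm_eq_inv_cpow, mul_div_assoc]
  · refine (summable_norm_thetaTerm hx hs).congr fun p => ?_
    rw [norm_thetaTerm hx, norm_mul, norm_natCast_add_one_cpow, norm_natCast_add_one_cpow,
      Complex.neg_re]

theorem mellin_polylogExp {s w : ℂ} (hw : 0 < w.re) (hsw : 1 < (s + w).re) :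
    mellin (polylogExp s) w = Complex.Gamma w * riemannZeta (s + w) := by
  have hterm : ∀ n : ℕ, (((n : ℝ) + 1 : ℝ) : ℂ) ^ (-s) / (((n : ℝ) + 1 : ℝ) : ℂ) ^ w =
      1 / ((n : ℂ) + 1) ^ (s + w) := fun n => by
    have hn : ((n : ℂ) + 1) ≠ 0 := by exact_mod_cast n.succ_ne_zero
    push_cast
    rw [Complex.cpow_neg, Complex.cpow_add _ _ hn]
    field_simp
  have h := hasSum_mellin (s := w) (a := fun n : ℕ => (((n : ℝ) + 1 : ℝ) : ℂ) ^ (-s))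
    (p := fun n : ℕ => (n : ℝ) + 1) (fun n => Or.inr (by positivity)) hw
    (fun t ht => hasSum_polylogExp s ht) ?_
  · rw [← h.tsum_eq, zeta_eq_tsum_one_div_nat_add_one_cpow hsw, ← tsum_mul_left]
    exact tsum_congr fun n => by rw [← hterm, mul_div_assoc]
  · have := (summable_nat_add_iff 1).mpr
      (Real.summable_nat_rpow (p := -(s + w).re) |>.mpr (by linarith))
    refine this.congr fun n => ?_
    have hn : (0 : ℝ) < n + 1 := by positivity
    rw [norm_natCast_add_one_cpow, Complex.neg_re, Complex.add_re, neg_add, div_eq_mul_inv,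
      ← Real.rpow_neg hn.le, ← Real.rpow_add hn]
    push_cast
    rfl

theorem norm_polylogExp_le_norm_ofReal {s : ℂ} {σ t : ℝ} (hσ : σ ≤ s.re) (ht : 0 < t) :
    ‖polylogExp s t‖ ≤ ‖polylogExp σ t‖ := by
  refine (norm_polylogExp_le hσ ht).trans_eq ?_
  rw [polylogExp_ofReal, Complex.norm_real, Real.norm_of_nonneg (tsum_nonneg fun n => ?_)]
  positivity

theorem mellinConvergent_polylogExp {s w : ℂ} (hw : 0 < w.re) (hsw : 1 < (s + w).re) :
    MellinConvergent (polylogExp s) w := by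
  have h : MellinConvergent (polylogExp (s.re : ℂ)) (w.re : ℂ) := by
    -- The integral of a non-integrable function is `0` by convention, whereas this one equals `Γ(w)
    -- ζ(s+w) ≠ 0` at real parameters.
    refine MeasureTheory.Integrable.of_integral_ne_zero ?_
    have := mellin_polylogExp (s := (s.re : ℂ)) (w := (w.re : ℂ)) (by simpa using hw)
      (by simpa using hsw)
    rw [mellin] at this
    rw [this]
    refine mul_ne_zero (Complex.Gamma_ne_zero_of_re_pos (by simpa using hw))
      (riemannZeta_ne_zero_of_one_lt_re (by simpa using hsw))
  refine MeasureTheory.Integrable.mono h ?_ ?_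
  · refine ContinuousOn.aestronglyMeasurable (fun t ht => ?_) measurableSet_Ioi
    have ht' : (t : ℂ) ∈ Complex.slitPlane := Complex.ofReal_mem_slitPlane.mpr ht
    exact (Complex.continuous_ofReal.continuousAt.cpow
      continuousAt_const ht').continuousWithinAt.smul (continuousOn_polylogExp s t ht)
  · filter_upwards [MeasureTheory.ae_restrict_mem measurableSet_Ioi] with t ht
    rw [norm_smul, norm_smul, Complex.norm_cpow_eq_rpow_re_of_pos ht,
      Complex.norm_cpow_eq_rpow_re_of_pos ht]
    simp only [Complex.sub_re, Complex.one_re, Complex.ofReal_re]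
    exact mul_le_mul_of_nonneg_left (norm_polylogExp_le_norm_ofReal le_rfl ht)
      (Real.rpow_nonneg (le_of_lt ht) _)

theorem hasMellin_polylogExp_comp_mul (hx : 0 < x) {s w : ℂ} (hw : 0 < w.re)
    (hsw : 1 < (s + w).re) :
    HasMellin (fun t => polylogExp s (x * t)) w
      ((x : ℂ) ^ (-w) * (Complex.Gamma w * riemannZeta (s + w))) := by
  refine ⟨(MellinConvergent.comp_mul_left hx).mpr (mellinConvergent_polylogExp hw hsw), ?_⟩
  rw [mellin_comp_mul_left _ _ hx, mellin_polylogExp hw hsw, smul_eq_mul]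

/-! ### The remainder integral -/

/-- The contribution of the remainder of order `K + 1` to the Mellin transform. -/
noncomputable def mellinRem (x : ℝ) (K : ℕ) (s : ℂ) : ℂ :=
  mellin (fun t => polylogRem (K + 1) s t * polylogExp s (x * t)) s

/-- Provides one integrable majorant for all exponents in an interval, covering `t ≤ 1` and `t ≥ 1`
together. -/
theorem rpow_le_rpow_add_rpow {t σ₁ σ σ₂ : ℝ} (ht : 0 < t) (h₁ : σ₁ ≤ σ) (h₂ : σ ≤ σ₂) :
    t ^ σ ≤ t ^ σ₁ + t ^ σ₂ := by
  rcases le_total 1 t with h | h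
  · exact (Real.rpow_le_rpow_of_exponent_le h h₂).trans
      (le_add_of_nonneg_left (Real.rpow_nonneg ht.le _))
  · exact (Real.rpow_le_rpow_of_exponent_ge ht h h₁).trans
      (le_add_of_nonneg_right (Real.rpow_nonneg ht.le _))

theorem aestronglyMeasurable_mellinRem_integrand (hx : 0 < x) (K : ℕ) (s : ℂ) :
    MeasureTheory.AEStronglyMeasurable (fun t : ℝ => (t : ℂ) ^ (s - 1) •
      (polylogRem (K + 1) s t * polylogExp s (x * t)))
        (MeasureTheory.volume.restrict (Set.Ioi 0)) := by
  have hcomp : ContinuousOn (fun t => polylogExp s (x * t)) (Set.Ioi 0) :=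
    (continuousOn_polylogExp s).comp (by fun_prop) fun t ht => mul_pos hx ht
  refine ContinuousOn.aestronglyMeasurable (ContinuousOn.fun_smul (fun t ht => ?_)
    ((continuousOn_polylogRem _ s).fun_mul hcomp)) measurableSet_Ioi
  have ht' : (t : ℂ) ∈ Complex.slitPlane := Complex.ofReal_mem_slitPlane.mpr ht
  exact (Complex.continuous_ofReal.continuousAt.cpow continuousAt_const ht').continuousWithinAt

/-- With the remainder bounded by `C t^(K+1)`, the integrand is controlled by the Mellin integral of
the second factor at `w = σ + K + 1`. Its convergence condition `σ + w > 1` reads `2σ + K > 0`. -/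
theorem mellinRem_locally_dominated (hx : 0 < x) (K : ℕ) {s₀ : ℂ} (h1 : s₀.re < 1)
    (h0 : -K < 2 * s₀.re) : ∃ V ∈ 𝓝 s₀, ∃ b : ℝ → ℝ,
      MeasureTheory.IntegrableOn b (Set.Ioi 0) ∧
      ∀ᵐ t : ℝ ∂(MeasureTheory.volume.restrict (Set.Ioi 0)), ∀ s ∈ V,
        ‖(t : ℂ) ^ (s - 1) • (polylogRem (K + 1) s t * polylogExp s (x * t))‖ ≤ b t := by
  obtain ⟨C, hC0, hC⟩ := exists_norm_polylogRem_succ_le K h1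
  -- With this choice `2σ₁ + K = 2δ > 0`, so convergence survives at the lower edge of the
  -- neighbourhood.
  set δ : ℝ := (2 * s₀.re + K) / 4 with hδ
  have hδ0 : 0 < δ := by rw [hδ]; linarith
  set σ₁ : ℝ := s₀.re - δ with hσ₁
  set σ₂ : ℝ := s₀.re + δ with hσ₂
  have hK : (0 : ℝ) ≤ K := Nat.cast_nonneg K
  have hlow : ∀ᶠ s : ℂ in 𝓝 s₀, σ₁ < s.re :=
    Complex.continuous_re.continuousAt.eventually_const_lt (by linarith)
  have hupp : ∀ᶠ s : ℂ in 𝓝 s₀, s.re < σ₂ :=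
    Complex.continuous_re.continuousAt.eventually_lt_const (by linarith)
  have hconv : ∀ σ : ℝ, σ₁ ≤ σ → MeasureTheory.IntegrableOn
      (fun t : ℝ => t ^ (σ + K) * ‖polylogExp σ₁ (x * t)‖) (Set.Ioi 0) := by
    intro σ hσ
    have := (hasMellin_polylogExp_comp_mul hx (s := (σ₁ : ℂ)) (w := ((σ + K + 1 : ℝ) : ℂ))
      (by rw [Complex.ofReal_re]; linarith)
      (by rw [Complex.add_re, Complex.ofReal_re, Complex.ofReal_re]; linarith)).1
    refine MeasureTheory.IntegrableOn.congr_fun (MeasureTheory.Integrable.norm this)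
      (fun t ht => ?_) measurableSet_Ioi
    simp only [norm_smul]
    rw [Complex.norm_cpow_eq_rpow_re_of_pos ht]
    simp
  refine ⟨_, hC.and (hlow.and hupp), fun t => C * (t ^ (σ₁ + K) * ‖polylogExp σ₁ (x * t)‖ +
    t ^ (σ₂ + K) * ‖polylogExp σ₁ (x * t)‖), ?_, ?_⟩
  · exact ((hconv σ₁ le_rfl).add (hconv σ₂ (by linarith))).const_mul C
  · filter_upwards [MeasureTheory.ae_restrict_mem measurableSet_Ioi] with t ht s hs
    obtain ⟨hs, hs1, hs2⟩ := hs
    have ht' : 0 < t := ht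
    rw [norm_smul, norm_mul, Complex.norm_cpow_eq_rpow_re_of_pos ht]
    have e1 := hs t ht
    have e2 := norm_polylogExp_le_norm_ofReal hs1.le (mul_pos hx ht)
    calc t ^ (s - 1).re * (‖polylogRem (K + 1) s t‖ * ‖polylogExp s (x * t)‖)
        ≤ t ^ (s - 1).re * ((C * t ^ (K + 1)) * ‖polylogExp σ₁ (x * t)‖) := by gcongr
      _ = C * (t ^ (s.re + K) * ‖polylogExp σ₁ (x * t)‖) := by
          rw [Complex.sub_re, Complex.one_re,
            show s.re + K = (s.re - 1) + ((K + 1 : ℕ) : ℝ) by push_cast; ring,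
            Real.rpow_add ht', Real.rpow_natCast]
          ring
      _ ≤ C * ((t ^ (σ₁ + K) + t ^ (σ₂ + K)) * ‖polylogExp σ₁ (x * t)‖) := by
          gcongr
          exact rpow_le_rpow_add_rpow ht' (by linarith) (by linarith)
      _ = _ := by ring

theorem mellinConvergent_rem (hx : 0 < x) (K : ℕ) {s : ℂ} (h1 : s.re < 1) (h0 : -K < 2 * s.re) :
    MellinConvergent (fun t => polylogRem (K + 1) s t * polylogExp s (x * t)) s := by
  obtain ⟨V, hV, b, hb, hle⟩ := mellinRem_locally_dominated hx K h1 h0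
  exact MeasureTheory.Integrable.mono' hb (aestronglyMeasurable_mellinRem_integrand hx K s)
    (hle.mono fun t ht => ht s (mem_of_mem_nhds hV))

theorem differentiableOn_mellinRem (hx : 0 < x) (K : ℕ) :
    DifferentiableOn ℂ (mellinRem x K) {s : ℂ | s.re < 1 ∧ -K < 2 * s.re} := by
  have hU : IsOpen {s : ℂ | s.re < 1 ∧ -(K : ℝ) < 2 * s.re} :=
    (isOpen_lt Complex.continuous_re continuous_const).inter
      (isOpen_lt continuous_const (continuous_const.mul Complex.continuous_re))
  refine differentiableOn_integral_of_locally_dominated hU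
    (fun s _ => aestronglyMeasurable_mellinRem_integrand hx K s) ?_
    fun s₀ hs₀ => mellinRem_locally_dominated hx K hs₀.1 hs₀.2
  filter_upwards [MeasureTheory.ae_restrict_mem measurableSet_Ioi] with t ht
  have ht' : (t : ℂ) ≠ 0 := Complex.ofReal_ne_zero.mpr (ne_of_gt ht)
  simp only [smul_eq_mul]
  refine DifferentiableOn.mul ?_ (((differentiableOn_polylogRem _ ht).mono
    fun s (hs : s.re < 1 ∧ _) => hs.1).mul (differentiable_polylogExp (mul_pos hx ht)).differentiableOn)
  have hid : Differentiable ℂ fun s : ℂ => s - 1 := by fun_prop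
  exact (hid.const_cpow (Or.inl ht')).differentiableOn

theorem hasMellin_finset_sum {ι : Type*} (S : Finset ι) {f : ι → ℝ → ℂ} {s : ℂ} {m : ι → ℂ}
    (h : ∀ i ∈ S, HasMellin (f i) s (m i)) :
    HasMellin (fun t => ∑ i ∈ S, f i t) s (∑ i ∈ S, m i) := by
  constructor
  · have := MeasureTheory.integrable_finsetSum S fun i hi => (h i hi).1
    refine this.congr (MeasureTheory.ae_of_all _ fun t => ?_)
    simp [Finset.mul_sum]
  · rw [← Finset.sum_congr rfl fun i hi => (h i hi).2]
    simp only [mellin, Finset.smul_sum]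
    exact MeasureTheory.integral_finsetSum S fun i hi => (h i hi).1

/-- The Mellin transform of `polylogExp s t * polylogExp s (x * t)`, with the first factor
expanded at `t = 0`. -/
theorem Gamma_mul_thetaSeries (hx : 0 < x) (K : ℕ) {s : ℂ} (hs : 2 / 3 < s.re) (hs1 : s.re < 1) :
    Complex.Gamma s * thetaSeries s s s x =
      Complex.Gamma (1 - s) * ((x : ℂ) ^ (1 - 2 * s) *
        (Complex.Gamma (2 * s - 1) * riemannZeta (3 * s - 1))) +
      ∑ k ∈ Finset.range (K + 1), riemannZeta (s - k) * ((-1) ^ k / k.factorial) *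
        ((x : ℂ) ^ (-s - k) * (Complex.Gamma (s + k) * riemannZeta (2 * s + k))) +
      mellinRem x K s := by
  have hK : (0 : ℝ) ≤ K := Nat.cast_nonneg K
  -- A factor `t ^ a` shifts the Mellin variable of the second factor from `s` to `s + a`.
  have hpow : ∀ a : ℂ, 0 < (s + a).re → 1 < (s + (s + a)).re → ∀ c : ℂ,
      HasMellin (fun t : ℝ => c • ((t : ℂ) ^ a • polylogExp s (x * t))) s
        (c * ((x : ℂ) ^ (-(s + a)) * (Complex.Gamma (s + a) * riemannZeta (s + (s + a))))) := by
    intro a h1 h2 c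
    have h := hasMellin_polylogExp_comp_mul hx h1 h2
    have h' := MellinConvergent.cpow_smul.mpr h.1
    refine ⟨h'.const_smul c, ?_⟩
    rw [mellin_const_smul, mellin_cpow_smul, h.2, smul_eq_mul]
  -- Here the Mellin variable is `2s - 1`, and the convergence condition `Re (3s - 1) > 1` is `Re s
  -- > 2/3` again.
  have hlead := hpow (s - 1) (by simp; linarith) (by simp; linarith) (Complex.Gamma (1 - s))
  have hsum := hasMellin_finset_sum (Finset.range (K + 1)) fun (k : ℕ) _ =>
    hpow k (by simp; linarith [(Nat.cast_nonneg k : (0 : ℝ) ≤ k)])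
      (by simp; linarith [(Nat.cast_nonneg k : (0 : ℝ) ≤ k)])
      (riemannZeta (s - k) * ((-1) ^ k / k.factorial))
  have hrem := mellinConvergent_rem hx K hs1 (by linarith)
  have h12 := hasMellin_add hlead.1 hsum.1
  have h123 := hasMellin_add h12.1 hrem
  have heq := h123.2
  rw [h12.2, hlead.2, hsum.2] at heq
  rw [← mellin_polylogExp_mul hx hs, mellinRem]
  refine Eq.trans ?_ (heq.trans ?_)
  · refine MeasureTheory.setIntegral_congr_fun measurableSet_Ioi fun t ht => ?_
    have hdec : polylogExp s t = Complex.Gamma (1 - s) * (t : ℂ) ^ (s - 1) +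
        (∑ k ∈ Finset.range (K + 1), riemannZeta (s - k) * ((-(t : ℂ)) ^ k / k.factorial)) +
        polylogRem (K + 1) s t := by
      rw [polylogRem, polylogReg]
      ring
    simp only [smul_eq_mul]
    rw [hdec, add_mul, add_mul, Finset.sum_mul]
    congr 3
    · ring
    · refine Finset.sum_congr rfl fun k _ => ?_
      rw [Complex.cpow_natCast, neg_pow]
      ring
  · congr 2
    · rw [show -(s + (s - 1)) = 1 - 2 * s by ring, show s + (s - 1) = 2 * s - 1 by ring,
        show s + (2 * s - 1) = 3 * s - 1 by ring]
    · refine Finset.sum_congr rfl fun k _ => ?_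
      rw [show -(s + (k : ℂ)) = -s - k by ring, show s + (s + (k : ℂ)) = 2 * s + k by ring]

/-! ### Continuation to a strip -/

/-- The leading term of the expansion of `Θ(s, s, s, x)`. -/
noncomputable def thetaLead (x : ℝ) (s : ℂ) : ℂ :=
  Complex.Gamma (1 - s) * 2 ^ (2 * s - 2) / (√Real.pi : ℝ) * (x : ℂ) ^ (1 - 2 * s) *
    (Complex.Gamma (s - 1 / 2) * riemannZeta (3 * s - 1))

/-- The `k`-th lower order term of the expansion of `Θ(s, s, s, x)`. -/
noncomputable def thetaExpTerm (x : ℝ) (k : ℕ) (s : ℂ) : ℂ :=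
  (-1) ^ k / k.factorial * (ascPochhammer ℂ k).eval s * (x : ℂ) ^ (-s - k) *
    riemannZeta (s - k) * riemannZeta (2 * s + k)

/-- The continuation of `Θ(s, s, s, x)` to the strip `-K / 2 < Re s < 1`. -/
noncomputable def thetaStrip (x : ℝ) (K : ℕ) (s : ℂ) : ℂ :=
  thetaLead x s + ∑ k ∈ Finset.range (K + 1), thetaExpTerm x k s +
    (Complex.Gamma s)⁻¹ * mellinRem x K s

/-- Dividing by `Γ(s)` removes spurious poles: by duplication `Γ(2s-1)/Γ(s)` becomes a multiple of
`Γ(s-1/2)`, and `Γ(s+k)/Γ(s)` is the polynomial `(s)_k`. -/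
theorem thetaSeries_eq_thetaStrip (hx : 0 < x) (K : ℕ) {s : ℂ} (hs : 2 / 3 < s.re)
    (hs1 : s.re < 1) : thetaSeries s s s x = thetaStrip x K s := by
  have hΓ : Complex.Gamma s ≠ 0 := Complex.Gamma_ne_zero_of_re_pos (by linarith)
  refine mul_left_cancel₀ hΓ ?_
  rw [Gamma_mul_thetaSeries hx K hs hs1, thetaStrip, mul_add, mul_add, Finset.mul_sum,
    mul_inv_cancel_left₀ hΓ]
  congr 2
  · have hdup := Complex.Gamma_mul_Gamma_add_half (s - 1 / 2)
    rw [sub_add_cancel, show 2 * (s - 1 / 2) = 2 * s - 1 by ring,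
      show 1 - (2 * s - 1) = -(2 * s - 2) by ring, Complex.cpow_neg] at hdup
    have hπ : ((√Real.pi : ℝ) : ℂ) ≠ 0 := by
      exact_mod_cast (Real.sqrt_pos.mpr Real.pi_pos).ne'
    have h2 : (2 : ℂ) ^ (2 * s - 2) ≠ 0 := by simp [Complex.cpow_eq_zero_iff]
    rw [thetaLead]
    have : Complex.Gamma (2 * s - 1) = Complex.Gamma (s - 1 / 2) * Complex.Gamma s *
        2 ^ (2 * s - 2) / (√Real.pi : ℝ) := by
      rw [hdup]
      field_simp
    rw [this]
    ring
  · refine Finset.sum_congr rfl fun k _ => ?_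
    have : Complex.Gamma (s + k) = Complex.Gamma s * (ascPochhammer ℂ k).eval s := by
      rw [← Complex.Gamma_add_nat_div_Gamma_eq s fun m h => ?_, mul_div_cancel₀ _ hΓ]
      have := congrArg Complex.re h
      simp at this
      linarith [(Nat.cast_nonneg m : (0 : ℝ) ≤ m)]
    rw [thetaExpTerm, this]
    ring

end ThetaSeries

/-! ### Calculus of simple poles -/

/-- `f` has at most a simple pole at `a`, and its residue there is `c`. -/
def HasSimplePrincipalPart (f : ℂ → ℂ) (a c : ℂ) : Prop :=
  ∃ h : ℂ → ℂ, AnalyticAt ℂ h a ∧ ∀ᶠ s in 𝓝[≠] a, f s = c / (s - a) + h s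

namespace HasSimplePrincipalPart

variable {f g : ℂ → ℂ} {a c d : ℂ}

theorem of_analyticAt (hf : AnalyticAt ℂ f a) : HasSimplePrincipalPart f a 0 :=
  ⟨f, hf, Eventually.of_forall fun s => by simp⟩

theorem congr (hf : HasSimplePrincipalPart f a c) (h : ∀ᶠ s in 𝓝[≠] a, g s = f s) :
    HasSimplePrincipalPart g a c := by
  obtain ⟨h₁, ha, he⟩ := hf
  exact ⟨h₁, ha, by filter_upwards [he, h] with s hs hs' using hs'.trans hs⟩

theorem add (hf : HasSimplePrincipalPart f a c) (hg : HasSimplePrincipalPart g a d) :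
    HasSimplePrincipalPart (fun s => f s + g s) a (c + d) := by
  obtain ⟨h₁, ha₁, he₁⟩ := hf
  obtain ⟨h₂, ha₂, he₂⟩ := hg
  refine ⟨h₁ + h₂, ha₁.add ha₂, ?_⟩
  filter_upwards [he₁, he₂] with s h1 h2
  rw [h1, h2, Pi.add_apply]
  ring

theorem sum {ι : Type*} (S : Finset ι) {F : ι → ℂ → ℂ} {c : ι → ℂ}
    (h : ∀ i ∈ S, HasSimplePrincipalPart (F i) a (c i)) :
    HasSimplePrincipalPart (fun s => ∑ i ∈ S, F i s) a (∑ i ∈ S, c i) := by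
  classical
  induction S using Finset.induction_on with
  | empty => simpa using of_analyticAt analyticAt_const
  | insert i S hi ih =>
    simp only [Finset.sum_insert hi]
    exact (h i (Finset.mem_insert_self i S)).add
      (ih fun j hj => h j (Finset.mem_insert_of_mem hj))

/-- `g(s)/(s-a)` differs from `g(a)/(s-a)` by the difference quotient of `g` at `a`, which is
analytic. -/
theorem analyticAt_mul (hg : AnalyticAt ℂ g a) (hf : HasSimplePrincipalPart f a c) :
    HasSimplePrincipalPart (fun s => g s * f s) a (g a * c) := by
  obtain ⟨h, ha, he⟩ := hf
  obtain ⟨p, hp⟩ := hg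
  have hd : AnalyticAt ℂ (dslope g a) a := hp.has_fpower_series_dslope_fslope.analyticAt
  refine ⟨fun s => c * dslope g a s + g s * h s,
    (analyticAt_const.mul hd).add (hp.analyticAt.mul ha), ?_⟩
  filter_upwards [he, self_mem_nhdsWithin] with s hs hne
  have hne' : s - a ≠ 0 := sub_ne_zero.mpr hne
  rw [hs, dslope_of_ne _ hne, slope_def_field]
  field_simp
  ring

theorem comp_affine {α β : ℂ} (hα : α ≠ 0) (hf : HasSimplePrincipalPart f (α * a + β) c) :
    HasSimplePrincipalPart (fun s => f (α * s + β)) a (c / α) := by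
  obtain ⟨h, ha, he⟩ := hf
  refine ⟨fun s => h (α * s + β), ?_, ?_⟩
  · exact AnalyticAt.fun_comp (f := fun s => α * s + β) ha (by fun_prop)
  · have ht : Tendsto (fun s => α * s + β) (𝓝[≠] a) (𝓝[≠] (α * a + β)) := by
      refine tendsto_nhdsWithin_iff.mpr ⟨?_, ?_⟩
      · exact ((by fun_prop : Continuous fun s => α * s + β).tendsto a).mono_left
          nhdsWithin_le_nhds
      · filter_upwards [self_mem_nhdsWithin] with s hs
        simpa [hα] using hs
    filter_upwards [ht.eventually he, self_mem_nhdsWithin] with s hs hne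
    have hne' : s - a ≠ 0 := sub_ne_zero.mpr hne
    rw [hs, show α * s + β - (α * a + β) = α * (s - a) by ring]
    field_simp

theorem meromorphicAt (hf : HasSimplePrincipalPart f a c) : MeromorphicAt f a := by
  obtain ⟨h, ha, he⟩ := hf
  have h1 : MeromorphicAt (fun s => c / (s - a) + h s) a := by
    have := ha.meromorphicAt
    fun_prop
  exact h1.congr (he.mono fun s hs => hs.symm)

theorem meromorphicOrderAt_eq (hf : HasSimplePrincipalPart f a c) (hc : c ≠ 0) :
    meromorphicOrderAt f a = ((-1 : ℤ) : WithTop ℤ) := by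
  refine (meromorphicOrderAt_eq_int_iff hf.meromorphicAt).mpr ?_
  obtain ⟨h, ha, he⟩ := hf
  refine ⟨fun s => c + (s - a) * h s, by fun_prop, by simpa using hc, ?_⟩
  filter_upwards [he, self_mem_nhdsWithin] with s hs hne
  have hne' : s - a ≠ 0 := sub_ne_zero.mpr hne
  rw [hs, zpow_neg_one, smul_eq_mul]
  field_simp

theorem meromorphicOrderAt_nonneg (hf : HasSimplePrincipalPart f a 0) :
    0 ≤ meromorphicOrderAt f a := by
  obtain ⟨h, ha, he⟩ := hf
  rw [meromorphicOrderAt_congr (f₂ := h) (he.mono fun s hs => by simpa using hs)]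
  exact ha.meromorphicOrderAt_nonneg

theorem isBigO_sub (hf : HasSimplePrincipalPart f a c) :
    (fun s => f s - c / (s - a)) =O[𝓝[≠] a] fun _ => (1 : ℝ) := by
  obtain ⟨h, ha, he⟩ := hf
  have h1 : h =O[𝓝[≠] a] fun _ => (1 : ℝ) :=
    (ha.continuousAt.tendsto.mono_left nhdsWithin_le_nhds).isBigO_one ℝ
  refine h1.congr' ?_ EventuallyEq.rfl
  filter_upwards [he] with s hs
  rw [hs]
  ring

end HasSimplePrincipalPart

/-! ### Poles and special values of `ζ` and `Γ` -/

theorem analyticAt_riemannZeta {s : ℂ} (hs : s ≠ 1) : AnalyticAt ℂ riemannZeta s :=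
  Complex.analyticAt_iff_eventually_differentiableAt.mpr
    ((isOpen_ne.eventually_mem hs).mono fun _ hz => differentiableAt_riemannZeta hz)

theorem hasSimplePrincipalPart_riemannZeta_one : HasSimplePrincipalPart riemannZeta 1 1 := by
  refine ⟨riemannZeta₀,
    differentiable_riemannZeta₀.analyticAt 1, ?_⟩
  filter_upwards [self_mem_nhdsWithin] with s hs
  rw [riemannZeta_eq_inv_sub_add hs, one_div]

theorem analyticAt_Gamma {s : ℂ} (hs : ∀ m : ℕ, s ≠ -m) : AnalyticAt ℂ Complex.Gamma s := by
  have h : AnalyticAt ℂ (fun s => ((Complex.Gamma s)⁻¹)⁻¹) s :=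
    (Complex.differentiable_one_div_Gamma.analyticAt s).inv (inv_ne_zero (Complex.Gamma_ne_zero hs))
  simpa using h

/-- Induction through `Γ(s) = Γ(s+1)/s`, starting from `Γ(1) = 1`. -/
theorem hasSimplePrincipalPart_Gamma (n : ℕ) :
    HasSimplePrincipalPart Complex.Gamma (-n) ((-1) ^ n / n.factorial) := by
  induction n with
  | zero =>
    have h1 : HasSimplePrincipalPart (fun s : ℂ => s⁻¹) 0 1 :=
      ⟨0, analyticAt_const, Eventually.of_forall fun s => by simp⟩
    have h2 : AnalyticAt ℂ (fun s : ℂ => Complex.Gamma (s + 1)) 0 := by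
      refine AnalyticAt.fun_comp (f := fun s : ℂ => s + 1) (analyticAt_Gamma fun m h => ?_)
        (by fun_prop)
      have := congrArg Complex.re h
      simp at this
      linarith [(Nat.cast_nonneg m : (0 : ℝ) ≤ m)]
    have h3 := HasSimplePrincipalPart.analyticAt_mul h2 h1
    simp only [zero_add, Complex.Gamma_one, one_mul] at h3
    simp only [Nat.cast_zero, neg_zero, pow_zero, Nat.factorial_zero, Nat.cast_one, div_one]
    refine h3.congr ?_
    filter_upwards [self_mem_nhdsWithin] with s hs
    have hs' : s ≠ 0 := hs
    rw [Complex.Gamma_add_one s hs']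
    field_simp
  | succ n ih =>
    have hn : (-((n + 1 : ℕ) : ℂ)) ≠ 0 := neg_ne_zero.mpr (by exact_mod_cast n.succ_ne_zero)
    have h1 := HasSimplePrincipalPart.comp_affine (f := Complex.Gamma) (a := -((n + 1 : ℕ) : ℂ))
      (α := 1) (β := 1) (c := (-1) ^ n / n.factorial) one_ne_zero (by
        convert ih using 1
        push_cast
        ring)
    have h2 : AnalyticAt ℂ (fun s : ℂ => s⁻¹) (-((n + 1 : ℕ) : ℂ)) := analyticAt_inv hn
    have h3 := HasSimplePrincipalPart.analyticAt_mul h2 h1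
    have hval : (-((n + 1 : ℕ) : ℂ))⁻¹ * ((-1) ^ n / n.factorial / 1) =
        (-1) ^ (n + 1) / (n + 1).factorial := by
      rw [Nat.factorial_succ, pow_succ]
      have hn' : ((n : ℂ) + 1) ≠ 0 := by exact_mod_cast n.succ_ne_zero
      have hf : (n.factorial : ℂ) ≠ 0 := by exact_mod_cast n.factorial_ne_zero
      push_cast
      have : -1 + -(n : ℂ) ≠ 0 := fun h => hn' (by linear_combination -h)
      field_simp
    rw [hval] at h3
    refine h3.congr ?_
    filter_upwards [mem_nhdsWithin_of_mem_nhds (isOpen_ne.mem_nhds hn)] with s hs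
    rw [one_mul, Complex.Gamma_add_one s hs]
    field_simp [show s ≠ 0 from hs]

theorem Gamma_add_half_mul (j : ℕ) :
    Real.Gamma (j + 1 / 2) * (4 ^ j * j.factorial) = (2 * j).factorial * √Real.pi := by
  induction j with
  | zero => simp [Real.Gamma_one_half_eq, -one_div]
  | succ j ih =>
    have h : Real.Gamma (((j + 1 : ℕ) : ℝ) + 1 / 2) = (j + 1 / 2) * Real.Gamma (j + 1 / 2) := by
      rw [← Real.Gamma_add_one (by positivity)]
      push_cast
      ring_nf
    rw [h, Nat.factorial_succ, show 2 * (j + 1) = 2 * j + 1 + 1 by ring, Nat.factorial_succ,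
      Nat.factorial_succ, pow_succ]
    push_cast
    linear_combination (2 * (j : ℝ) + 2) * (2 * j + 1) * ih

theorem Complex.Gamma_half_add_nat (j : ℕ) : Complex.Gamma (1 / 2 + j) =
    (2 * j).factorial / (4 ^ j * j.factorial) * (√Real.pi : ℝ) := by
  have h := Gamma_add_half_mul j
  have h' : Real.Gamma (j + 1 / 2) = (2 * j).factorial / (4 ^ j * j.factorial) * √Real.pi := by
    have : (4 ^ j * (j.factorial : ℝ)) ≠ 0 := by positivity
    rw [div_mul_eq_mul_div, eq_div_iff this]
    exact h
  rw [show (1 / 2 + j : ℂ) = ((j + 1 / 2 : ℝ) : ℂ) by push_cast; ring, Complex.Gamma_ofReal, h']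
  push_cast
  rfl

/-- The left side is `Γ(1/2+j)/Γ(1/2-j)`, and reflection gives `Γ(1/2+j) Γ(1/2-j) = (-1)^j π`; hence
it equals `(-1)^j Γ(1/2+j)² / π`. -/
theorem ascPochhammer_eval_half_sub (j : ℕ) : (ascPochhammer ℂ (2 * j)).eval (1 / 2 - j : ℂ) =
    (-1) ^ j * ((2 * j).factorial / (4 ^ j * j.factorial)) ^ 2 := by
  have hne : ∀ k : ℕ, (1 / 2 - j : ℂ) ≠ -k := fun k h => by
    have h1 : ((1 + 2 * k : ℕ) : ℂ) = ((2 * j : ℕ) : ℂ) := by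
      push_cast
      linear_combination 2 * h
    have h2 : 1 + 2 * k = 2 * j := by exact_mod_cast h1
    omega
  have h1 := Complex.Gamma_add_nat_div_Gamma_eq (n := 2 * j) (1 / 2 - j : ℂ) hne
  have hrefl := Complex.Gamma_mul_Gamma_one_sub (1 / 2 + j : ℂ)
  rw [show (1 : ℂ) - (1 / 2 + j) = 1 / 2 - j by ring,
    show (Real.pi : ℂ) * (1 / 2 + j) = j * Real.pi + Real.pi / 2 by ring,
    Complex.sin_add_pi_div_two] at hrefl
  have hcos : Complex.cos (j * Real.pi) = (-1) ^ j := by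
    rw [show (j * Real.pi : ℂ) = ((j * Real.pi : ℝ) : ℂ) by push_cast; rfl, ← Complex.ofReal_cos,
      Real.cos_nat_mul_pi]
    push_cast
    rfl
  rw [hcos] at hrefl
  have hπ : (((√Real.pi : ℝ) : ℂ)) ^ 2 = Real.pi := by
    rw [← Complex.ofReal_pow, Real.sq_sqrt Real.pi_pos.le]
  have hπ0 : (Real.pi : ℂ) ≠ 0 := by exact_mod_cast Real.pi_ne_zero
  have hsq : ((-1 : ℂ) ^ j) * (-1) ^ j = 1 := by rw [← mul_pow]; simp
  have hΓ0 := Complex.Gamma_ne_zero hne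
  have h2 : (1 / 2 - j + (2 * j : ℕ) : ℂ) = 1 / 2 + j := by push_cast; ring
  rw [h2] at h1
  rw [← h1, div_eq_iff hΓ0]
  have h3 : Complex.Gamma (1 / 2 + j) * Complex.Gamma (1 / 2 - j) = Real.pi * (-1) ^ j := by
    rw [hrefl]
    have : ((-1 : ℂ) ^ j) ≠ 0 := by simp
    rw [div_eq_iff this, mul_assoc, hsq, mul_one]
  rw [Complex.Gamma_half_add_nat] at h3 ⊢
  have hs0 : ((√Real.pi : ℝ) : ℂ) ≠ 0 := by
    exact_mod_cast (Real.sqrt_pos.mpr Real.pi_pos).ne'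
  refine mul_left_cancel₀ hs0 ?_
  set d : ℂ := (2 * j).factorial / (4 ^ j * j.factorial)
  linear_combination (-(-1) ^ j * d) * h3 + d * hπ - d * Real.pi * hsq

/-! ### Principal parts of the continuation -/

section Poles

variable {x : ℝ}

theorem analyticAt_Gamma_one_sub {a : ℂ} (ha : a.re < 1) :
    AnalyticAt ℂ (fun s => Complex.Gamma (1 - s)) a :=
  DifferentiableOn.analyticAt (s := {s : ℂ | s.re < 1})
    (fun _ hs => (differentiableAt_Gamma_one_sub hs).differentiableWithinAt)
    ((isOpen_lt Complex.continuous_re continuous_const).mem_nhds ha)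

theorem analyticAt_thetaLead_prefactor (hx : 0 < x) {a : ℂ} (ha : a.re < 1) :
    AnalyticAt ℂ (fun s : ℂ => Complex.Gamma (1 - s) * 2 ^ (2 * s - 2) / (√Real.pi : ℝ) *
      (x : ℂ) ^ (1 - 2 * s)) a := by
  have h2 : AnalyticAt ℂ (fun s : ℂ => (2 : ℂ) ^ (2 * s - 2)) a := by
    refine Differentiable.analyticAt (fun s => ?_) a
    exact DifferentiableAt.const_cpow (by fun_prop) (Or.inl two_ne_zero)
  have h3 : AnalyticAt ℂ (fun s : ℂ => (x : ℂ) ^ (1 - 2 * s)) a := by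
    refine Differentiable.analyticAt (fun s => ?_) a
    exact DifferentiableAt.const_cpow (by fun_prop) (Or.inl (by exact_mod_cast hx.ne'))
  exact (((analyticAt_Gamma_one_sub ha).fun_mul h2).fun_div analyticAt_const
    (by exact_mod_cast (Real.sqrt_pos.mpr Real.pi_pos).ne')).fun_mul h3

theorem analyticAt_Gamma_sub_half {a : ℂ} (ha : ∀ j : ℕ, a ≠ 1 / 2 - j) :
    AnalyticAt ℂ (fun s => Complex.Gamma (s - 1 / 2)) a :=
  AnalyticAt.fun_comp (f := fun s : ℂ => s - 1 / 2)
    (analyticAt_Gamma fun m h => ha m (by linear_combination h)) (by fun_prop)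

theorem analyticAt_riemannZeta_affine {a α β : ℂ} (ha : α * a + β ≠ 1) :
    AnalyticAt ℂ (fun s => riemannZeta (α * s + β)) a :=
  AnalyticAt.fun_comp (f := fun s : ℂ => α * s + β) (analyticAt_riemannZeta ha) (by fun_prop)

theorem hasSimplePrincipalPart_riemannZeta_affine {a α β : ℂ} (hα : α ≠ 0) (ha : α * a + β = 1) :
    HasSimplePrincipalPart (fun s => riemannZeta (α * s + β)) a (1 / α) :=
  HasSimplePrincipalPart.comp_affine hα (by
    rw [ha]
    exact hasSimplePrincipalPart_riemannZeta_one)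

theorem half_sub_natCast_ne_two_thirds (j : ℕ) : (1 / 2 - j : ℂ) ≠ 2 / 3 := by
  intro h
  have := congrArg Complex.re h
  norm_num at this
  linarith [(Nat.cast_nonneg j : (0 : ℝ) ≤ j)]

theorem half_sub_natCast_re_lt (j : ℕ) : (1 / 2 - j : ℂ).re < 1 := by
  norm_num
  linarith [(Nat.cast_nonneg j : (0 : ℝ) ≤ j)]

theorem analyticAt_thetaLead (hx : 0 < x) {a : ℂ} (ha : a.re < 1) (h1 : a ≠ 2 / 3)
    (h2 : ∀ j : ℕ, a ≠ 1 / 2 - j) : AnalyticAt ℂ (thetaLead x) a := by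
  have h3 : AnalyticAt ℂ (fun s => riemannZeta (3 * s - 1)) a := by
    simpa only [← sub_eq_add_neg] using analyticAt_riemannZeta_affine (a := a) (α := 3) (β := -1)
      fun h => h1 (by linear_combination h / 3)
  exact (analyticAt_thetaLead_prefactor hx ha).fun_mul ((analyticAt_Gamma_sub_half h2).fun_mul h3)

/-- The left side is, up to the power of `x`, the residue of the leading term at `2/3`. Duplication
at `1/6` eliminates `Γ(1/6)`, and reflection at `1/3` eliminates `Γ(2/3)`. -/
theorem Gamma_third_identity : Complex.Gamma (1 / 3) * 2 ^ (-(2 / 3) : ℂ) / (√Real.pi : ℝ) *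
    Complex.Gamma (1 / 6) / 3 = ((Real.Gamma (1 / 3) ^ 3 / (2 * √3 * Real.pi) : ℝ) : ℂ) := by
  have hdup := Real.Gamma_mul_Gamma_add_half (1 / 6)
  have hrefl := Real.Gamma_mul_Gamma_one_sub (1 / 3)
  rw [show (1 / 6 + 1 / 2 : ℝ) = 2 / 3 by norm_num, show (2 * (1 / 6) : ℝ) = 1 / 3 by norm_num,
    show (1 - 1 / 3 : ℝ) = 2 / 3 by norm_num] at hdup
  rw [show Real.pi * (1 / 3) = Real.pi / 3 by ring, Real.sin_pi_div_three,
    show (1 - 1 / 3 : ℝ) = 2 / 3 by norm_num] at hrefl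
  have h3 : √3 ^ 2 = (3 : ℝ) := Real.sq_sqrt (by norm_num)
  have h30 : 0 < √(3 : ℝ) := Real.sqrt_pos.mpr (by norm_num)
  have hπ0 : 0 < √Real.pi := Real.sqrt_pos.mpr Real.pi_pos
  have hπ := Real.pi_pos
  have hΓ : 0 < Real.Gamma (2 / 3) := Real.Gamma_pos_of_pos (by norm_num)
  have h2 : (0 : ℝ) < 2 ^ (2 / 3 : ℝ) := by positivity
  have hreal : Real.Gamma (1 / 3) * 2 ^ (-(2 / 3) : ℝ) / √Real.pi * Real.Gamma (1 / 6) / 3 =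
      Real.Gamma (1 / 3) ^ 3 / (2 * √3 * Real.pi) := by
    have hΓ₁ : Real.Gamma (1 / 6) =
        Real.Gamma (1 / 3) * 2 ^ (2 / 3 : ℝ) * √Real.pi / Real.Gamma (2 / 3) := by
      rw [eq_div_iff hΓ.ne', hdup]
    have hΓ₂ : Real.Gamma (1 / 3) * Real.Gamma (2 / 3) * √3 = 2 * Real.pi := by
      rw [hrefl]
      field_simp
    rw [hΓ₁, Real.rpow_neg two_pos.le]
    generalize Real.Gamma (1 / 3) = G at *
    generalize Real.Gamma (2 / 3) = H at *
    generalize √Real.pi = q at *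
    generalize √(3 : ℝ) = r at *
    generalize (2 : ℝ) ^ (2 / 3 : ℝ) = p at *
    have hleft : G * p⁻¹ / q * (G * p * q / H) / 3 = G ^ 2 / (3 * H) := by
      field_simp
    rw [hleft, div_eq_div_iff (by positivity) (by positivity)]
    linear_combination -G ^ 2 * r * hΓ₂ + G ^ 3 * H * h3
  rw [← hreal]
  push_cast
  rw [Complex.ofReal_cpow (by norm_num : (0 : ℝ) ≤ 2), ← Complex.Gamma_ofReal, ← Complex.Gamma_ofReal]
  push_cast
  rfl

theorem hasSimplePrincipalPart_thetaLead_two_thirds (hx : 0 < x) :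
    HasSimplePrincipalPart (thetaLead x) (2 / 3)
      ((Real.Gamma (1 / 3) ^ 3 / (2 * √3 * Real.pi * x ^ (1 / 3 : ℝ)) : ℝ) : ℂ) := by
  have ha : (2 / 3 : ℂ).re < 1 := by norm_num
  have h1 := (analyticAt_thetaLead_prefactor hx ha).fun_mul
    (analyticAt_Gamma_sub_half fun j h => half_sub_natCast_ne_two_thirds j h.symm)
  have h2 := hasSimplePrincipalPart_riemannZeta_affine (a := 2 / 3) (α := 3) (β := -1)
    (by norm_num) (by norm_num)
  have h3 := HasSimplePrincipalPart.analyticAt_mul h1 h2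
  convert h3 using 1
  · funext s
    rw [thetaLead, ← sub_eq_add_neg]
    ring
  · rw [show (1 : ℂ) - 2 / 3 = 1 / 3 by norm_num, show (2 : ℂ) * (2 / 3) - 2 = -(2 / 3) by norm_num,
      show (1 : ℂ) - 2 * (2 / 3) = -(1 / 3) by norm_num,
      show (2 / 3 : ℂ) - 1 / 2 = 1 / 6 by norm_num]
    have hxp : (x : ℂ) ^ (-(1 / 3) : ℂ) = (((x ^ (1 / 3 : ℝ))⁻¹ : ℝ) : ℂ) := by
      rw [← Real.rpow_neg hx.le, Complex.ofReal_cpow hx.le]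
      push_cast
      rfl
    rw [hxp]
    have := Gamma_third_identity
    rw [show Real.Gamma (1 / 3) ^ 3 / (2 * √3 * Real.pi * x ^ (1 / 3 : ℝ)) =
      Real.Gamma (1 / 3) ^ 3 / (2 * √3 * Real.pi) * (x ^ (1 / 3 : ℝ))⁻¹ by
        rw [← div_div, div_eq_mul_inv _ (x ^ (1 / 3 : ℝ))], Complex.ofReal_mul, ← this]
    ring

theorem two_mul_factorial_eq (j : ℕ) :
    ((2 * j).factorial : ℂ) = (2 * j).choose j * (j.factorial * j.factorial) := by
  have := Nat.choose_mul_factorial_mul_factorial (Nat.le_mul_of_pos_left j two_pos)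
  rw [show 2 * j - j = j by omega] at this
  rw [← this]
  push_cast
  ring

theorem two_zpow_neg_four_mul (j : ℕ) : (2 : ℂ) ^ (-4 * (j : ℤ) - 1) = ((2 ^ j) ^ 4 * 2)⁻¹ := by
  rw [show -4 * (j : ℤ) - 1 = -((j * 4 + 1 : ℕ) : ℤ) by push_cast; ring, zpow_neg, zpow_natCast,
    pow_succ, pow_mul]

/-- Only `Γ(s-1/2)` is singular here, with residue `(-1)^j / j!`; the zeta factor is regular because
`3s - 1 = 1/2 - 3j ≠ 1`. -/
theorem hasSimplePrincipalPart_thetaLead_half_sub (hx : 0 < x) (j : ℕ) :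
    HasSimplePrincipalPart (thetaLead x) (1 / 2 - j)
      ((-1) ^ j * (2 : ℂ) ^ (-4 * (j : ℤ) - 1) * ((2 * j).choose j : ℂ) *
        ((x ^ (2 * j) : ℝ) : ℂ) * riemannZeta ((1 - 6 * (j : ℂ)) / 2)) := by
  have ha : (1 / 2 - j : ℂ).re < 1 := half_sub_natCast_re_lt j
  have hζ : AnalyticAt ℂ (fun s => riemannZeta (3 * s + -1)) (1 / 2 - j) :=
    analyticAt_riemannZeta_affine fun h =>
      half_sub_natCast_ne_two_thirds j (by linear_combination h / 3)
  have h1 := (analyticAt_thetaLead_prefactor hx ha).fun_mul hζ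
  have h2 := HasSimplePrincipalPart.comp_affine (f := Complex.Gamma) (a := (1 / 2 - j : ℂ))
    (α := 1) (β := -(1 / 2)) (c := (-1) ^ j / j.factorial) one_ne_zero (by
      convert hasSimplePrincipalPart_Gamma j using 1
      ring)
  have h3 := HasSimplePrincipalPart.analyticAt_mul h1 h2
  convert h3 using 1
  · funext s
    rw [thetaLead, ← sub_eq_add_neg, ← sub_eq_add_neg, one_mul]
    ring
  · have e1 : (2 : ℂ) ^ (2 * (1 / 2 - j : ℂ) - 2) = ((2 ^ j) ^ 2 * 2)⁻¹ := by
      rw [show 2 * (1 / 2 - j : ℂ) - 2 = -((j * 2 + 1 : ℕ) : ℂ) by push_cast; ring,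
        Complex.cpow_neg, Complex.cpow_natCast, pow_succ, pow_mul]
    have e2 : (x : ℂ) ^ (1 - 2 * (1 / 2 - j : ℂ)) = (x : ℂ) ^ (2 * j) := by
      rw [show 1 - 2 * (1 / 2 - j : ℂ) = ((2 * j : ℕ) : ℂ) by push_cast; ring,
        Complex.cpow_natCast]
    rw [e1, e2, show (1 : ℂ) - (1 / 2 - j) = 1 / 2 + j by ring, Complex.Gamma_half_add_nat,
      two_zpow_neg_four_mul, two_mul_factorial_eq, show 3 * (1 / 2 - j : ℂ) + -1 =
        (1 - 6 * j) / 2 by ring, show (4 : ℂ) ^ j = (2 ^ j) ^ 2 by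
          rw [← pow_mul, mul_comm, pow_mul]; norm_num]
    have hs0 : ((√Real.pi : ℝ) : ℂ) ≠ 0 := by
      exact_mod_cast (Real.sqrt_pos.mpr Real.pi_pos).ne'
    have hf : (j.factorial : ℂ) ≠ 0 := by exact_mod_cast j.factorial_ne_zero
    have hu : ((2 : ℂ) ^ j) ≠ 0 := by simp
    push_cast
    field_simp

theorem analyticAt_thetaExpTerm_prefactor (hx : 0 < x) (k : ℕ) {a : ℂ} (ha : a.re < 1) :
    AnalyticAt ℂ (fun s : ℂ => (-1) ^ k / k.factorial * (ascPochhammer ℂ k).eval s *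
      (x : ℂ) ^ (-s - k) * riemannZeta (s - k)) a := by
  have h1 : AnalyticAt ℂ (fun s : ℂ => (ascPochhammer ℂ k).eval s) a :=
    (ascPochhammer ℂ k).differentiable.analyticAt a
  have h2 : AnalyticAt ℂ (fun s : ℂ => (x : ℂ) ^ (-s - k)) a := by
    refine Differentiable.analyticAt (fun s => ?_) a
    exact DifferentiableAt.const_cpow (by fun_prop) (Or.inl (by exact_mod_cast hx.ne'))
  have h3 : AnalyticAt ℂ (fun s => riemannZeta (s - k)) a := by
    refine AnalyticAt.fun_comp (f := fun s : ℂ => s - k) (analyticAt_riemannZeta fun h => ?_)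
      (by fun_prop)
    have := congrArg Complex.re h
    simp at this
    linarith [(Nat.cast_nonneg k : (0 : ℝ) ≤ k)]
  exact ((analyticAt_const.fun_mul h1).fun_mul h2).fun_mul h3

theorem analyticAt_thetaExpTerm (hx : 0 < x) (k : ℕ) {a : ℂ} (ha : a.re < 1)
    (hk : 2 * a + k ≠ 1) : AnalyticAt ℂ (thetaExpTerm x k) a :=
  (analyticAt_thetaExpTerm_prefactor hx k ha).fun_mul (analyticAt_riemannZeta_affine hk)

theorem hasSimplePrincipalPart_thetaExpTerm_of_eq (hx : 0 < x) (k : ℕ) {a : ℂ} (ha : a.re < 1)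
    (hk : 2 * a + k = 1) : HasSimplePrincipalPart (thetaExpTerm x k) a
      ((-1) ^ k / k.factorial * (ascPochhammer ℂ k).eval a * (x : ℂ) ^ (-a - k) *
        riemannZeta (a - k) * (1 / 2)) :=
  HasSimplePrincipalPart.analyticAt_mul (analyticAt_thetaExpTerm_prefactor hx k ha)
    (hasSimplePrincipalPart_riemannZeta_affine two_ne_zero hk)

/-- The only candidate pole is `s = (1-k)/2`. For `k = 2j + 1` this is `s = -j`, a zero of `(s)_k`,
so odd terms never contribute. -/
theorem hasSimplePrincipalPart_thetaExpTerm_of_ne (hx : 0 < x) (k : ℕ) {a : ℂ} (ha : a.re < 1)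
    (hne : ∀ j : ℕ, k = 2 * j → a ≠ 1 / 2 - j) :
    HasSimplePrincipalPart (thetaExpTerm x k) a 0 := by
  by_cases hk : 2 * a + k = 1
  · rcases Nat.even_or_odd' k with ⟨j, rfl | rfl⟩
    · exact absurd (by push_cast at hk; linear_combination hk / 2) (hne j rfl)
    · have haj : a = -j := by push_cast at hk; linear_combination hk / 2
      have h := hasSimplePrincipalPart_thetaExpTerm_of_eq hx (2 * j + 1) ha hk
      have h0 : (ascPochhammer ℂ (2 * j + 1)).eval a = 0 := by
        rw [haj]
        exact ascPochhammer_eval_neg_coe_nat_of_lt (by omega)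
      rw [h0] at h
      simpa using h
  · exact .of_analyticAt (analyticAt_thetaExpTerm hx k ha hk)

theorem hasSimplePrincipalPart_thetaExpTerm_half_sub (hx : 0 < x) (j : ℕ) :
    HasSimplePrincipalPart (thetaExpTerm x (2 * j)) (1 / 2 - j)
      ((-1) ^ j * (2 : ℂ) ^ (-4 * (j : ℤ) - 1) * ((2 * j).choose j : ℂ) *
        ((x ^ (-(1 / 2 : ℝ) - (j : ℝ)) : ℝ) : ℂ) * riemannZeta ((1 - 6 * (j : ℂ)) / 2)) := by
  convert hasSimplePrincipalPart_thetaExpTerm_of_eq hx (2 * j) (half_sub_natCast_re_lt j)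
    (by push_cast; ring) using 1
  have e1 : (x : ℂ) ^ (-(1 / 2 - j : ℂ) - (2 * j : ℕ)) =
      ((x ^ (-(1 / 2 : ℝ) - (j : ℝ)) : ℝ) : ℂ) := by
    rw [Complex.ofReal_cpow hx.le]
    push_cast
    congr 1
    ring
  rw [e1, ascPochhammer_eval_half_sub, two_zpow_neg_four_mul, two_mul_factorial_eq,
    show (1 / 2 - j - (2 * j : ℕ) : ℂ) = (1 - 6 * j) / 2 by push_cast; ring,
    show (4 : ℂ) ^ j = (2 ^ j) ^ 2 by rw [← pow_mul, mul_comm, pow_mul]; norm_num, pow_mul]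
  have hf : (j.factorial : ℂ) ≠ 0 := by exact_mod_cast j.factorial_ne_zero
  have hc : ((2 * j).choose j : ℂ) ≠ 0 := by
    exact_mod_cast (Nat.choose_pos (Nat.le_mul_of_pos_left j two_pos)).ne'
  have hu : ((2 : ℂ) ^ j) ≠ 0 := by simp
  simp only [even_two, Even.neg_pow, one_pow]
  field_simp

theorem analyticAt_thetaStrip_rem (hx : 0 < x) (K : ℕ) {a : ℂ} (ha : a.re < 1)
    (ha' : -K < 2 * a.re) :
    AnalyticAt ℂ (fun s => (Complex.Gamma s)⁻¹ * mellinRem x K s) a := by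
  have hU : IsOpen {s : ℂ | s.re < 1 ∧ -(K : ℝ) < 2 * s.re} :=
    (isOpen_lt Complex.continuous_re continuous_const).inter
      (isOpen_lt continuous_const (continuous_const.mul Complex.continuous_re))
  exact (Complex.differentiable_one_div_Gamma.analyticAt a).fun_mul
    ((differentiableOn_mellinRem hx K).analyticAt (hU.mem_nhds ⟨ha, ha'⟩))

theorem hasSimplePrincipalPart_thetaStrip (hx : 0 < x) (K : ℕ) {a c₁ : ℂ} {c₂ : ℕ → ℂ}
    (ha : a.re < 1) (ha' : -K < 2 * a.re) (h1 : HasSimplePrincipalPart (thetaLead x) a c₁)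
    (h2 : ∀ k, HasSimplePrincipalPart (thetaExpTerm x k) a (c₂ k)) :
    HasSimplePrincipalPart (thetaStrip x K) a (c₁ + ∑ k ∈ Finset.range (K + 1), c₂ k) := by
  have h := (h1.add (HasSimplePrincipalPart.sum (Finset.range (K + 1)) fun k _ => h2 k)).add
    (.of_analyticAt (analyticAt_thetaStrip_rem hx K ha ha'))
  rwa [add_zero] at h

theorem hasSimplePrincipalPart_thetaStrip_two_thirds (hx : 0 < x) (K : ℕ) :
    HasSimplePrincipalPart (thetaStrip x K) (2 / 3)
      ((Real.Gamma (1 / 3) ^ 3 / (2 * √3 * Real.pi * x ^ (1 / 3 : ℝ)) : ℝ) : ℂ) := by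
  have hre : (2 / 3 : ℂ).re = 2 / 3 := by norm_num
  have ha : (2 / 3 : ℂ).re < 1 := by norm_num
  have h := hasSimplePrincipalPart_thetaStrip hx K (c₂ := fun _ => 0) ha
    (by rw [hre]; linarith [(Nat.cast_nonneg K : (0 : ℝ) ≤ K)])
    (hasSimplePrincipalPart_thetaLead_two_thirds hx) fun k =>
      hasSimplePrincipalPart_thetaExpTerm_of_ne hx k ha
        fun j _ h => half_sub_natCast_ne_two_thirds j h.symm
  simpa using h

/-- Two terms are singular at this point: the leading one gives `x^(2j)` and the term `k = 2j` gives
`x^(-1/2-j)`. The condition `2j ≤ K` puts that term in the sum and the point in the strip. -/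
theorem hasSimplePrincipalPart_thetaStrip_half_sub (hx : 0 < x) {K j : ℕ} (hK : 2 * j ≤ K) :
    HasSimplePrincipalPart (thetaStrip x K) (1 / 2 - j)
      ((-1) ^ j * (2 : ℂ) ^ (-4 * (j : ℤ) - 1) * ((2 * j).choose j : ℂ) *
        ((x ^ (2 * j) + x ^ (-(1 / 2 : ℝ) - (j : ℝ)) : ℝ) : ℂ) *
          riemannZeta ((1 - 6 * (j : ℂ)) / 2)) := by
  have hK' : (2 * j : ℝ) ≤ K := by exact_mod_cast hK
  have hre : (1 / 2 - j : ℂ).re = 1 / 2 - j := by norm_num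
  set c : ℂ := (-1) ^ j * (2 : ℂ) ^ (-4 * (j : ℤ) - 1) * ((2 * j).choose j : ℂ) *
    ((x ^ (-(1 / 2 : ℝ) - (j : ℝ)) : ℝ) : ℂ) * riemannZeta ((1 - 6 * (j : ℂ)) / 2) with hc
  have h := hasSimplePrincipalPart_thetaStrip hx K (c₂ := fun k => if k = 2 * j then c else 0)
    (half_sub_natCast_re_lt j) (by rw [hre]; linarith)
    (hasSimplePrincipalPart_thetaLead_half_sub hx j) fun k => by
      split_ifs with hk
      · rw [hk]
        exact hasSimplePrincipalPart_thetaExpTerm_half_sub hx j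
      · refine hasSimplePrincipalPart_thetaExpTerm_of_ne hx k (half_sub_natCast_re_lt j)
          fun i hi h => hk ?_
        have : (i : ℂ) = j := by linear_combination h
        rw [hi, Nat.cast_injective this]
  rw [Finset.sum_ite_eq' (Finset.range (K + 1)) (2 * j) fun _ => c,
    if_pos (Finset.mem_range.mpr (by omega))] at h
  convert h using 1
  rw [hc]
  push_cast
  ring

theorem hasSimplePrincipalPart_thetaStrip_zero (hx : 0 < x) (K : ℕ) {a : ℂ} (ha : a.re < 1)
    (ha' : -K < 2 * a.re) (h1 : a ≠ 2 / 3) (h2 : ∀ j : ℕ, a ≠ 1 / 2 - j) :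
    HasSimplePrincipalPart (thetaStrip x K) a 0 := by
  have h := hasSimplePrincipalPart_thetaStrip hx K (c₂ := fun _ => 0) ha ha'
    (.of_analyticAt (analyticAt_thetaLead hx ha h1 h2)) fun k =>
      hasSimplePrincipalPart_thetaExpTerm_of_ne hx k ha fun j _ => h2 j
  simpa using h

theorem meromorphicAt_thetaStrip (hx : 0 < x) (K : ℕ) {a : ℂ} (ha : a.re < 1)
    (ha' : -K < 2 * a.re) : MeromorphicAt (thetaStrip x K) a := by
  by_cases h1 : a = 2 / 3
  · rw [h1]
    exact (hasSimplePrincipalPart_thetaStrip_two_thirds hx K).meromorphicAt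
  by_cases h2 : ∃ j : ℕ, a = 1 / 2 - j
  · obtain ⟨j, rfl⟩ := h2
    refine (hasSimplePrincipalPart_thetaStrip_half_sub hx ?_).meromorphicAt
    have hre : (1 / 2 - j : ℂ).re = 1 / 2 - j := by norm_num
    rw [hre] at ha'
    have : (2 * j : ℝ) < K + 1 := by linarith
    have : 2 * j < K + 1 := by exact_mod_cast this
    omega
  · exact (hasSimplePrincipalPart_thetaStrip_zero hx K ha ha' h1
      fun j hj => h2 ⟨j, hj⟩).meromorphicAt

end Poles

/-! ### Non-vanishing of `ζ(1/2 - 3j)` -/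

theorem antitoneOn_rpow_mul_exp_neg {t : ℝ} (ht : 0 < t) :
    AntitoneOn (fun u : ℝ => u ^ (-(1 / 2) : ℝ) * Real.exp (-(t * u))) (Set.Ioi 0) := by
  intro u hu v hv huv
  have hu' : 0 < u := hu
  have h1 : v ^ (-(1 / 2) : ℝ) ≤ u ^ (-(1 / 2) : ℝ) :=
    Real.rpow_le_rpow_of_nonpos hu' huv (by norm_num)
  have h2 : Real.exp (-(t * v)) ≤ Real.exp (-(t * u)) :=
    Real.exp_le_exp.mpr (by nlinarith)
  exact mul_le_mul h1 h2 (Real.exp_pos _).le (by positivity)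

/-- Comparison of the sum `∑ n ^ (-1/2) * exp (-n * t)` with the corresponding integral. -/
theorem tsum_rpow_mul_exp_neg_le {t : ℝ} (ht : 0 < t) :
    ∑' n : ℕ, ((n : ℝ) + 1) ^ (-(1 / 2) : ℝ) * Real.exp (-((n : ℝ) + 1) * t) ≤
      (∫ u in Set.Ioi (0 : ℝ), u ^ (-(1 / 2) : ℝ) * Real.exp (-(t * u))) - Real.exp (-t) := by
  set f : ℝ → ℝ := fun u => u ^ (-(1 / 2) : ℝ) * Real.exp (-(t * u)) with hf
  have hint : MeasureTheory.IntegrableOn f (Set.Ioi 0) := by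
    have := integrableOn_rpow_mul_exp_neg_mul (σ := 1 / 2) (by norm_num) ht
    rwa [show (1 / 2 - 1 : ℝ) = -(1 / 2) by norm_num] at this
  have hnn : ∀ u ∈ Set.Ioi (0 : ℝ), 0 ≤ f u := fun u hu =>
    mul_nonneg (Real.rpow_nonneg (le_of_lt hu) _) (Real.exp_pos _).le
  have hsum := summable_rpow_mul_exp_neg (-(1 / 2)) ht
  have hterm : ∀ n : ℕ, ((n : ℝ) + 1) ^ (-(1 / 2) : ℝ) * Real.exp (-((n : ℝ) + 1) * t) =
      f (n + 1) := fun n => by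
    rw [hf]
    ring_nf
  simp only [hterm] at hsum ⊢
  have htail : ∀ N : ℕ, ∑ n ∈ Finset.range N, f (((n + 1 : ℕ) : ℝ) + 1) ≤
      ∫ u in Set.Ioi (1 : ℝ), f u := by
    intro N
    have h1 := AntitoneOn.sum_le_integral (f := f) (x₀ := 1) (a := N)
      ((antitoneOn_rpow_mul_exp_neg ht).mono fun u hu => one_pos.trans_le hu.1)
    rw [intervalIntegral.integral_of_le (by simp)] at h1
    refine (Finset.sum_congr rfl fun n _ => by rw [add_comm]).trans_le (h1.trans ?_)
    refine MeasureTheory.setIntegral_mono_set (hint.mono_set (Set.Ioi_subset_Ioi zero_le_one)) ?_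
      (Set.Ioc_subset_Ioi_self.eventuallyLE)
    filter_upwards [MeasureTheory.ae_restrict_mem measurableSet_Ioi] with u hu
    have hu' : (1 : ℝ) < u := hu
    exact hnn u (one_pos.trans hu')
  have htail' : ∑' n : ℕ, f (((n + 1 : ℕ) : ℝ) + 1) ≤ ∫ u in Set.Ioi (1 : ℝ), f u :=
    Real.tsum_le_of_sum_range_le (fun n => hnn _ (by
      rw [Set.mem_Ioi]; positivity)) htail
  -- The integral over `(0, 1]` is at least `exp (-t) ∫ u^(-1/2) = 2 exp (-t)`, while the first term
  -- of the sum is only `exp (-t)`; the surplus is the gain claimed.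
  have hhead : 2 * Real.exp (-t) ≤ ∫ u in Set.Ioc (0 : ℝ) 1, f u := by
    have h1 : ∫ u in Set.Ioc (0 : ℝ) 1, u ^ (-(1 / 2) : ℝ) * Real.exp (-t) =
        2 * Real.exp (-t) := by
      rw [MeasureTheory.integral_mul_const, ← intervalIntegral.integral_of_le zero_le_one,
        integral_rpow (Or.inl (by norm_num))]
      norm_num
    rw [← h1]
    refine MeasureTheory.setIntegral_mono_on ?_ (hint.mono_set Set.Ioc_subset_Ioi_self)
      measurableSet_Ioc fun u hu => ?_
    · refine MeasureTheory.Integrable.mul_const ?_ _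
      exact (intervalIntegrable_iff_integrableOn_Ioc_of_le zero_le_one).mp
        (intervalIntegral.intervalIntegrable_rpow' (by norm_num))
    · refine mul_le_mul_of_nonneg_left (Real.exp_le_exp.mpr ?_) (Real.rpow_nonneg hu.1.le _)
      nlinarith [hu.2]
  have hsplit : ∫ u in Set.Ioi (0 : ℝ), f u =
      (∫ u in Set.Ioc (0 : ℝ) 1, f u) + ∫ u in Set.Ioi (1 : ℝ), f u := by
    rw [← MeasureTheory.setIntegral_union (Set.Ioc_disjoint_Ioi le_rfl) measurableSet_Ioi
      (hint.mono_set Set.Ioc_subset_Ioi_self) (hint.mono_set (Set.Ioi_subset_Ioi zero_le_one)),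
      Set.Ioc_union_Ioi_eq_Ioi zero_le_one]
  have hfirst : f (((0 : ℕ) : ℝ) + 1) = Real.exp (-t) := by simp [hf]
  rw [hsum.tsum_eq_zero_add, hfirst, hsplit]
  linarith

/-- `ζ(1/2)` is the limit of the regular part, and the singular part `Γ(1/2) t^(-1/2)` is precisely
the comparison integral. So the regular part is sum minus integral, at most `-exp (-t)`, which tends
to `-1`. -/
theorem riemannZeta_one_half_re_le : (riemannZeta (1 / 2)).re ≤ -1 := by
  have h1 := (Complex.continuous_re.tendsto _).comp
    (tendsto_polylogReg (s := 1 / 2) (by norm_num))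
  have h2 : Tendsto (fun t : ℝ => -Real.exp (-t)) (𝓝[>] 0) (𝓝 (-1)) := by
    have : Continuous fun t : ℝ => -Real.exp (-t) := by fun_prop
    exact (this.tendsto' 0 (-1) (by simp)).mono_left nhdsWithin_le_nhds
  refine le_of_tendsto_of_tendsto h1 h2 ?_
  filter_upwards [self_mem_nhdsWithin] with t ht
  have ht' : 0 < t := ht
  have h3 := tsum_rpow_mul_exp_neg_le ht'
  have h4 := Real.integral_rpow_mul_exp_neg_mul_Ioi (a := 1 / 2) (by norm_num) ht'
  rw [show (1 / 2 - 1 : ℝ) = -(1 / 2) by norm_num] at h4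
  rw [h4] at h3
  have h5 : polylogReg (1 / 2) t = (((∑' n : ℕ, ((n : ℝ) + 1) ^ (-(1 / 2) : ℝ) *
      Real.exp (-((n : ℝ) + 1) * t)) - (1 / t) ^ (1 / 2 : ℝ) * Real.Gamma (1 / 2) : ℝ) : ℂ) := by
    rw [polylogReg, Complex.ofReal_sub, ← polylogExp_ofReal]
    congr 1
    · push_cast
      rfl
    · rw [one_div t, Real.inv_rpow ht'.le, ← Real.rpow_neg ht'.le, Complex.ofReal_mul,
        Complex.ofReal_cpow ht'.le, ← Complex.Gamma_ofReal, mul_comm]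
      push_cast
      norm_num
  simp only [Function.comp_apply]
  rw [h5, Complex.ofReal_re]
  linarith

/-- For `j ≥ 1` the functional equation reflects the point to `1/2 + 3j`, inside the half-plane of
absolute convergence. The case `j = 0` lies on the critical line and needs the explicit bound on
`ζ(1/2)`. -/
theorem riemannZeta_half_sub_ne_zero (j : ℕ) : riemannZeta ((1 - 6 * (j : ℂ)) / 2) ≠ 0 := by
  rcases Nat.eq_zero_or_pos j with rfl | hj
  · intro h
    have := riemannZeta_one_half_re_le
    norm_num at h
    norm_num [h] at this
  · have hj' : (1 : ℝ) ≤ j := by exact_mod_cast hj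
    have hre : (1 / 2 + 3 * j : ℂ).re = 1 / 2 + 3 * j := by norm_num
    have hfe := riemannZeta_one_sub (s := 1 / 2 + 3 * j) (fun n h => by
      have := congrArg Complex.re h
      rw [hre] at this
      simp at this
      linarith [(Nat.cast_nonneg n : (0 : ℝ) ≤ n)]) (fun h => by
      have := congrArg Complex.re h
      rw [hre] at this
      simp at this
      linarith)
    rw [show (1 - 6 * (j : ℂ)) / 2 = 1 - (1 / 2 + 3 * j) by ring, hfe]
    have hπ : (Real.pi : ℂ) ≠ 0 := by exact_mod_cast Real.pi_ne_zero
    refine mul_ne_zero (mul_ne_zero (mul_ne_zero (mul_ne_zero two_ne_zero ?_) ?_) ?_) ?_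
    · exact fun h => mul_ne_zero two_ne_zero hπ ((Complex.cpow_eq_zero_iff _ _).mp h).1
    · exact Complex.Gamma_ne_zero_of_re_pos (by rw [hre]; linarith)
    · rw [Complex.cos_ne_zero_iff]
      intro k h
      -- A zero of the cosine would make the odd number `1 + 6j` equal to an even one.
      have h1 : ((1 + 6 * j : ℤ) : ℂ) = ((2 * (2 * k + 1) : ℤ) : ℂ) := by
        refine mul_left_cancel₀ hπ ?_
        push_cast
        linear_combination 4 * h
      have h2 : (1 + 6 * j : ℤ) = 2 * (2 * k + 1) := by exact_mod_cast h1
      omega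
    · exact riemannZeta_ne_zero_of_one_lt_re (by rw [hre]; linarith)

/-! ### Gluing the strips and uniqueness of the continuation -/

/-- **Identity theorem** for meromorphic functions on a preconnected set. -/
theorem MeromorphicOn.eventuallyEq_nhdsNE_of_isPreconnected {f g : ℂ → ℂ} {U : Set ℂ}
    (hf : MeromorphicOn f U) (hg : MeromorphicOn g U) (hU : IsPreconnected U) {z₀ a : ℂ}
    (hz₀ : z₀ ∈ U) (h : f =ᶠ[𝓝[≠] z₀] g) (ha : a ∈ U) : f =ᶠ[𝓝[≠] a] g := by
  have h0 : meromorphicOrderAt (f - g) z₀ = ⊤ :=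
    meromorphicOrderAt_eq_top_iff.mpr (h.mono fun z hz => by simp [hz])
  have h1 : meromorphicOrderAt (f - g) a = ⊤ := by
    by_contra hne
    exact (hf.sub hg).meromorphicOrderAt_ne_top_of_isPreconnected hU ha hz₀ hne h0
  exact (meromorphicOrderAt_eq_top_iff.mp h1).mono fun z hz => sub_eq_zero.mp hz

section Continuation

variable {x : ℝ} {F : ℂ → ℂ}

theorem analyticAt_thetaSeries (hx : 0 < x) {s : ℂ} (hs : 2 / 3 < s.re) :
    AnalyticAt ℂ (fun s => thetaSeries s s s x) s :=
  (differentiableOn_thetaSeries hx).analyticAt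
    ((isOpen_lt continuous_const Complex.continuous_re).mem_nhds hs)

/-- A function that is meromorphic on a strip and agrees there with the double series as far as
it converges agrees with `thetaStrip`. -/
theorem eventuallyEq_thetaStrip (hx : 0 < x) {K : ℕ} {G : ℂ → ℂ}
    (hG : MeromorphicOn G {s : ℂ | -K < 2 * s.re ∧ s.re < 1})
    (hseries : ∀ s : ℂ, 2 / 3 < s.re → s.re < 1 → G s = thetaSeries s s s x) {a : ℂ}
    (ha' : -K < 2 * a.re) (ha : a.re < 1) : G =ᶠ[𝓝[≠] a] thetaStrip x K := by
  have hK : (0 : ℝ) ≤ K := Nat.cast_nonneg K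
  -- `5/6` is a base point in the overlap `2/3 < Re s < 1`, where both functions equal the series.
  have hre : ((5 / 6 : ℝ) : ℂ).re = 5 / 6 := Complex.ofReal_re _
  have hconv : Convex ℝ {s : ℂ | -(K : ℝ) < 2 * s.re ∧ s.re < 1} := by
    have h : {s : ℂ | -(K : ℝ) < 2 * s.re ∧ s.re < 1} =
        {s : ℂ | -(K : ℝ) / 2 < s.re} ∩ {s : ℂ | s.re < 1} := by
      ext s
      simp only [Set.mem_ofPred_eq, Set.mem_inter_iff, div_lt_iff₀ (two_pos : (0 : ℝ) < 2),
        mul_comm]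
    rw [h]
    exact (convex_halfSpace_re_gt _).inter (convex_halfSpace_re_lt 1)
  refine hG.eventuallyEq_nhdsNE_of_isPreconnected
    (fun s hs => meromorphicAt_thetaStrip hx K hs.2 hs.1) hconv.isPreconnected
    (z₀ := ((5 / 6 : ℝ) : ℂ)) ?_ ?_ ⟨ha', ha⟩
  · exact ⟨by rw [hre]; linarith, by rw [hre]; norm_num⟩
  · refine Filter.Eventually.filter_mono nhdsWithin_le_nhds ?_
    have h1 : ∀ᶠ s : ℂ in 𝓝 ((5 / 6 : ℝ) : ℂ), 2 / 3 < s.re :=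
      Complex.continuous_re.continuousAt.eventually_const_lt (by rw [hre]; norm_num)
    have h2 : ∀ᶠ s : ℂ in 𝓝 ((5 / 6 : ℝ) : ℂ), s.re < 1 :=
      Complex.continuous_re.continuousAt.eventually_lt_const (by rw [hre]; norm_num)
    filter_upwards [h1, h2] with s h1 h2
    rw [hseries s h1 h2, thetaSeries_eq_thetaStrip hx K h1 h2]

theorem thetaStrip_eventuallyEq (hx : 0 < x) {K M : ℕ} (hKM : K ≤ M) {a : ℂ}
    (ha' : -K < 2 * a.re) (ha : a.re < 1) : thetaStrip x K =ᶠ[𝓝[≠] a] thetaStrip x M := by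
  have hKM' : (K : ℝ) ≤ M := by exact_mod_cast hKM
  refine (eventuallyEq_thetaStrip hx (fun s hs => meromorphicAt_thetaStrip hx M hs.2 ?_)
    (fun s h1 h2 => (thetaSeries_eq_thetaStrip hx M h1 h2).symm) ha' ha).symm
  linarith [hs.1]

/-- The meromorphic continuation of `Θ(s, s, s, x)`, up to its values at the poles. -/
noncomputable def thetaContinuation (x : ℝ) (s : ℂ) : ℂ :=
  if 2 / 3 < s.re then thetaSeries s s s x else thetaStrip x (⌈2 * |s.re|⌉₊ + 2) s

theorem isThetaDiagContinuation_thetaContinuation (hx : 0 < x) :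
    IsThetaDiagContinuation x (thetaContinuation x) where
  eq_series s hs := if_pos hs
  meromorphic a := by
    by_cases ha : 2 / 3 < a.re
    · refine (analyticAt_thetaSeries hx ha).meromorphicAt.congr
        (Filter.Eventually.filter_mono nhdsWithin_le_nhds ?_)
      filter_upwards [(isOpen_lt continuous_const Complex.continuous_re).mem_nhds ha] with s hs
      exact (if_pos hs).symm
    · have ha1 : a.re < 1 := by linarith
      -- The strip index in the definition jumps with `Re s`. This `M` dominates every index
      -- occurring for `|Re s - Re a| < 1/2`, where `2|Re s| ≤ 2|Re a| + 1`.
      set M : ℕ := ⌈2 * |a.re| + 1⌉₊ + 2 with hM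
      have haM : -(M : ℝ) < 2 * a.re := by
        have := Nat.le_ceil (2 * |a.re| + 1)
        have := neg_abs_le a.re
        rw [hM]
        push_cast
        linarith
      -- Only finitely many indices occur, so one punctured neighbourhood serves for all comparisons
      -- with `M`.
      have hall : ∀ᶠ s in 𝓝[≠] a, ∀ k ∈ Finset.range (M + 1), -(k : ℝ) < 2 * a.re →
          thetaStrip x k s = thetaStrip x M s := by
        refine (Filter.eventually_all_finset _).mpr fun k hk => ?_
        by_cases hk' : -(k : ℝ) < 2 * a.re
        · exact (thetaStrip_eventuallyEq hx (Nat.lt_succ_iff.mp (Finset.mem_range.mp hk)) hk'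
            ha1).mono fun s hs _ => hs
        · exact Eventually.of_forall fun s h => absurd h hk'
      refine (meromorphicAt_thetaStrip hx M ha1 haM).congr ?_
      have hnear : ∀ᶠ s in 𝓝[≠] a, |s.re - a.re| < 1 / 2 := by
        refine Filter.Eventually.filter_mono nhdsWithin_le_nhds ?_
        have hc : Continuous fun s : ℂ => |s.re - a.re| := by fun_prop
        exact hc.continuousAt.eventually_lt_const (by simp)
      have hlt : ∀ᶠ s : ℂ in 𝓝[≠] a, s.re < 1 := Filter.Eventually.filter_mono nhdsWithin_le_nhds
        (Complex.continuous_re.continuousAt.eventually_lt_const ha1)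
      filter_upwards [hall, hnear, hlt] with s hs hnear hlt
      by_cases h : 2 / 3 < s.re
      · rw [thetaContinuation, if_pos h, thetaSeries_eq_thetaStrip hx M h hlt]
      · rw [thetaContinuation, if_neg h]
        have h1 : |a.re| ≤ |s.re| + |s.re - a.re| := by
          have := abs_sub_abs_le_abs_sub a.re s.re
          rw [abs_sub_comm] at this
          linarith
        have h2 : |s.re| ≤ |a.re| + |s.re - a.re| := by
          have := abs_sub_abs_le_abs_sub s.re a.re
          linarith
        refine (hs _ (Finset.mem_range.mpr ?_) ?_).symm
        · have : ⌈2 * |s.re|⌉₊ ≤ ⌈2 * |a.re| + 1⌉₊ := Nat.ceil_le_ceil (by linarith)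
          omega
        · have := Nat.le_ceil (2 * |s.re|)
          have := neg_abs_le a.re
          push_cast
          linarith

namespace IsThetaDiagContinuation

theorem eventuallyEq_strip (hF : IsThetaDiagContinuation x F) (hx : 0 < x) {K : ℕ} {a : ℂ}
    (ha' : -K < 2 * a.re) (ha : a.re < 1) : F =ᶠ[𝓝[≠] a] thetaStrip x K :=
  eventuallyEq_thetaStrip hx (fun s _ => hF.meromorphic s) (fun s h _ => hF.eq_series s h) ha' ha

theorem hasSimplePrincipalPart_two_thirds (hF : IsThetaDiagContinuation x F) (hx : 0 < x) :
    HasSimplePrincipalPart F (2 / 3)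
      ((Real.Gamma (1 / 3) ^ 3 / (2 * √3 * Real.pi * x ^ (1 / 3 : ℝ)) : ℝ) : ℂ) :=
  (hasSimplePrincipalPart_thetaStrip_two_thirds hx 0).congr
    (hF.eventuallyEq_strip hx (by norm_num) (by norm_num))

theorem hasSimplePrincipalPart_half_sub (hF : IsThetaDiagContinuation x F) (hx : 0 < x) (j : ℕ) :
    HasSimplePrincipalPart F (1 / 2 - j)
      ((-1) ^ j * (2 : ℂ) ^ (-4 * (j : ℤ) - 1) * (Nat.choose (2 * j) j : ℂ) *
        ((x ^ (2 * j) + x ^ (-(1 / 2 : ℝ) - (j : ℝ)) : ℝ) : ℂ) *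
          riemannZeta ((1 - 6 * (j : ℂ)) / 2)) := by
  have hre : (1 / 2 - j : ℂ).re = 1 / 2 - j := by norm_num
  refine (hasSimplePrincipalPart_thetaStrip_half_sub hx (le_refl (2 * j))).congr
    (hF.eventuallyEq_strip hx ?_ (half_sub_natCast_re_lt j))
  rw [hre]
  push_cast
  linarith

theorem meromorphicOrderAt_nonneg (hF : IsThetaDiagContinuation x F) (hx : 0 < x) {a : ℂ}
    (h1 : a ≠ 2 / 3) (h2 : ∀ j : ℕ, a ≠ 1 / 2 - j) : 0 ≤ meromorphicOrderAt F a := by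
  rcases lt_or_ge a.re 1 with ha | ha
  · obtain ⟨K, hK⟩ := exists_nat_gt (-(2 * a.re))
    have hK' : -(K : ℝ) < 2 * a.re := by linarith
    exact ((hasSimplePrincipalPart_thetaStrip_zero hx K ha hK' h1 h2).congr
      (hF.eventuallyEq_strip hx hK' ha)).meromorphicOrderAt_nonneg
  · have ha' : 2 / 3 < a.re := by linarith
    refine ((HasSimplePrincipalPart.of_analyticAt (analyticAt_thetaSeries hx ha')).congr
      (Filter.Eventually.filter_mono nhdsWithin_le_nhds ?_)).meromorphicOrderAt_nonneg
    filter_upwards [(isOpen_lt continuous_const Complex.continuous_re).mem_nhds ha'] with s hs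
    exact hF.eq_series s hs

end IsThetaDiagContinuation

end Continuation

/-! ### The main theorem -/

theorem theorem10 (x : ℝ) (hx : 0 < x) :
    -- the series converges absolutely for `2 / 3 < Re s`
    (∀ s : ℂ, 2 / 3 < s.re → Summable (fun p : ℕ × ℕ => ‖thetaTerm s s s x p‖)) ∧
    -- its sum has a meromorphic continuation to the plane
    (∃ F : ℂ → ℂ, IsThetaDiagContinuation x F) ∧
    -- which (removable discontinuities apart) has exactly the following singularities
    ∀ F : ℂ → ℂ, IsThetaDiagContinuation x F →
      {s : ℂ | meromorphicOrderAt F s < 0} =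
        {(2 / 3 : ℂ)} ∪ Set.range (fun j : ℕ => (1 / 2 : ℂ) - (j : ℂ)) ∧
      (meromorphicOrderAt F (2 / 3) = ((-1 : ℤ) : WithTop ℤ) ∧
        (fun s : ℂ => F s -
            ((Real.Gamma (1 / 3) ^ 3 / (2 * √3 * Real.pi * x ^ (1 / 3 : ℝ)) : ℝ) : ℂ) /
              (s - 2 / 3))
          =O[𝓝[≠] (2 / 3 : ℂ)] (fun _ => (1 : ℝ))) ∧
      ∀ j : ℕ,
        meromorphicOrderAt F (1 / 2 - (j : ℂ)) = ((-1 : ℤ) : WithTop ℤ) ∧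
        (fun s : ℂ => F s -
            ((-1) ^ j * (2 : ℂ) ^ (-4 * (j : ℤ) - 1) * (Nat.choose (2 * j) j : ℂ) *
              ((x ^ (2 * j) + x ^ (-(1 / 2 : ℝ) - (j : ℝ)) : ℝ) : ℂ) *
              riemannZeta ((1 - 6 * (j : ℂ)) / 2)) / (s - (1 / 2 - (j : ℂ))))
          =O[𝓝[≠] (1 / 2 - (j : ℂ))] (fun _ => (1 : ℝ)) := by
  refine ⟨fun s hs => summable_norm_thetaTerm hx hs,
    ⟨thetaContinuation x, isThetaDiagContinuation_thetaContinuation hx⟩, fun F hF => ?_⟩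
  have hlead := hF.hasSimplePrincipalPart_two_thirds hx
  have hhalf := hF.hasSimplePrincipalPart_half_sub hx
  have hneg : ((-1 : ℤ) : WithTop ℤ) < 0 := by exact_mod_cast (by norm_num : (-1 : ℤ) < 0)
  have horder : meromorphicOrderAt F (2 / 3) = ((-1 : ℤ) : WithTop ℤ) := by
    refine hlead.meromorphicOrderAt_eq (Complex.ofReal_ne_zero.mpr ?_)
    have h1 : 0 < Real.Gamma (1 / 3) := Real.Gamma_pos_of_pos (by norm_num)
    have h2 := Real.pi_pos
    positivity
  have horder' : ∀ j : ℕ, meromorphicOrderAt F (1 / 2 - (j : ℂ)) = ((-1 : ℤ) : WithTop ℤ) := by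
    intro j
    -- The pole is genuine: `x^(2j) + x^(-1/2-j)` is positive, so its two sources do not cancel, and
    -- the zeta value is nonzero.
    refine (hhalf j).meromorphicOrderAt_eq (mul_ne_zero (mul_ne_zero (mul_ne_zero (mul_ne_zero
      (by simp) (zpow_ne_zero _ two_ne_zero)) ?_) (Complex.ofReal_ne_zero.mpr ?_))
        (riemannZeta_half_sub_ne_zero j))
    · exact_mod_cast (Nat.choose_pos (Nat.le_mul_of_pos_left j two_pos)).ne'
    · positivity
  refine ⟨?_, ⟨horder, hlead.isBigO_sub⟩, fun j => ⟨horder' j, (hhalf j).isBigO_sub⟩⟩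
  ext s
  simp only [Set.mem_ofPred_eq, Set.mem_union, Set.mem_singleton_iff, Set.mem_range]
  constructor
  · intro hs
    by_contra! h
    exact absurd (hF.meromorphicOrderAt_nonneg hx h.1 fun j hj => h.2 j hj.symm) (not_le.mpr hs)
  · rintro (rfl | ⟨j, rfl⟩)
    · rw [horder]
      exact hneg
    · rw [horder' j]
      exact hneg
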